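/- Setting. Let $\mu(x;\theta)$ be a known mean function, $\theta=(\theta_1,\theta_2)\in\Theta\subset\mathbb{R}^{p_1}\times\mathbb{R}^{q}$, and $V_0$ a known working variance function. Let $\rho$ be the law of $(X,Y)$ in the super-population, with $Y$ integrable and $E(Y\mid X)=\mu(X;\theta_0)$, and let the null hypothesis $H_0:\theta_{0,2}=\theta_2^{(0)}$ hold. (The working variance need not be the true conditional variance.) On $\Theta$, $\mu(x;\cdot)$ is twice continuously differentiable, and $V_0$ is continuously differentiable and positive at the values $\mu(x;\theta)$, $\theta\in\Theta$. Put $$u(\theta;x,y)=\frac{y-\mu(x;\theta)}{V_0(\mu(x;\theta))}\frac{\partial\mu(x;\theta)}{\partial\theta},\qquad I(\theta;x,y)=-\frac{\partial u(\theta;x,y)}{\partial\theta^{T}},\qquad \mathcal{I}(\theta)=E\{I(\theta;X,Y)\}.$$ Along a sequence of finite populations, each consisting of $N$ independent units $(x_i,y_i)$ with law $\rho$, a sample $A$ of size $n=|A|$ is drawn by a (possibly informative) design with first-order inclusion probabilities $\pi_i>0$ given the finite population; let $w_i=\pi_i^{-1}$ and $$\hat S_w(\theta)=N^{-1}\sum_{i\in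 A}w_i\,u(\theta;x_i,y_i),\qquad \hat I_w(\theta)=N^{-1}\sum_{i\in A}w_i\,I(\theta;x_i,y_i),$$ with blocks $\hat S_{wj}$, $\hat I_{wjk}$ ($j,k=1,2$) according to $\theta=(\theta_1,\theta_2)$. Let $n_0=E|A|$ (so $n_0=n$ when the sample size is not random); all probabilities, variances and limits refer to the joint distribution of the super-population model and the sampling mechanism. Regularity conditions. (i) $n_0\to\infty$, and $n/n_0\to1$ in probability. (ii) $n_0\,\mathrm{var}\{\hat S_w(\theta_0)\}\to\Sigma_S$ for a positive definite matrix $\Sigma_S$. (iii) For some neighbourhood $B\subset\Theta$ of $\theta_0$, $I(\theta;X,Y)$ is integrable for $\theta\in B$, $\hat I_w(\theta)\to\mathcal{I}(\theta)$ in probability uniformly in $\theta\in B$, and $\mathcal{I}(\theta_0)$ is invertible. (iv) $\mathrm{var}\{\hat S_w(\theta_0)\}^{-1/2}\hat S_w(\theta_0)\to N(0,I)$ in distribution, where here $I$ is the identity matrix. Statistic. Let $\hat\theta_1^{(0)}$ be the solution of the profiled equation: with probability tending to one, $\hat\theta_1^{(0)}$ is the unique $\theta_1$ with $(\theta_1,\theta_2^{(0)})\in\Theta$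 and $\hat S_{w1}(\theta_1,\theta_2^{(0)})=0$. With $\hat\theta^{(0)}=(\hat\theta_1^{(0)},\theta_2^{(0)})$ and $\hat I_{w22\cdot1}=\hat I_{w22}-\hat I_{w21}\hat I_{w11}^{-1}\hat I_{w12}$, let $$X_{QS}^2(\theta_2^{(0)})=\hat S_{w2}(\hat\theta^{(0)})^{T}\{\hat I_{w22\cdot1}(\hat\theta^{(0)})\}^{-1}\hat S_{w2}(\hat\theta^{(0)}).$$ Conclusion. Let $\Sigma_\theta=\mathcal{I}(\theta_0)^{-1}\Sigma_S\{\mathcal{I}(\theta_0)^{-1}\}^{T}$, let $\Sigma_{\theta,22}$ be its $q\times q$ block belonging to $\theta_2$, and let $\mathcal{I}_{22\cdot1}=\mathcal{I}_{22}-\mathcal{I}_{21}\mathcal{I}_{11}^{-1}\mathcal{I}_{12}$ at $\theta_0$. Then the eigenvalues of $P=\Sigma_{\theta,22}\,\mathcal{I}_{22\cdot1}$, counted with algebraic multiplicity, are real and positive, $c_1\ge\dots\ge c_q>0$, and $$n\,X_{QS}^2(\theta_2^{(0)})\longrightarrow\mathcal{G}_1=\sum_{i=1}^q c_iZ_i^2\quad\text{in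 distribution},$$ where $Z_1,\dots,Z_q$ are independent standard normal variables. -/

import Mathlib

open MeasureTheory ProbabilityTheory Filter Topology

/-- Parameter vectors `θ = (θ₁, θ₂)` with `θ₁ ∈ ℝ^p₁` (nuisance) and `θ₂ ∈ ℝ^q` (tested). -/
abbrev Param (p₁ q : ℕ) : Type := Fin p₁ ⊕ Fin q → ℝ

/-- The known ingredients of a quasi-score: the mean function `μ(x; θ)` and the working variance
function `V₀`. -/
structure QuasiModel (𝒳 : Type*) (p₁ q : ℕ) where
  /-- The mean function `μ(x; θ)`. -/
  mean : 𝒳 → Param p₁ q → ℝ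
  /-- The working variance function `V₀`. -/
  workVar : ℝ → ℝ

namespace QuasiModel

variable {𝒳 : Type*} {p₁ q : ℕ}

/-- The quasi-score `u(θ; x, y) = (y - μ) {V₀(μ)}⁻¹ ∂μ/∂θ` with `μ = μ(x; θ)`;
a unit `z` is a pair `(x, y)`. -/
noncomputable def score (M : QuasiModel 𝒳 p₁ q) (θ : Param p₁ q) (z : 𝒳 × ℝ) : Param p₁ q :=
  fun j => (z.2 - M.mean z.1 θ) * (M.workVar (M.mean z.1 θ))⁻¹ *
    fderiv ℝ (M.mean z.1) θ (Pi.single j 1)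

/-- The matrix `I(θ; x, y) = - ∂u(θ; x, y)/∂θᵀ`. -/
noncomputable def info (M : QuasiModel 𝒳 p₁ q) (θ : Param p₁ q) (z : 𝒳 × ℝ) :
    Matrix (Fin p₁ ⊕ Fin q) (Fin p₁ ⊕ Fin q) ℝ :=
  Matrix.of fun j k => - fderiv ℝ (fun t => M.score t z j) θ (Pi.single k 1)

/-- The matrix `𝓘(θ) = E{I(θ; X, Y)}`, where `(X, Y)` has law `ρ`. -/
noncomputable def popInfo [MeasurableSpace 𝒳] (M : QuasiModel 𝒳 p₁ q) (ρ : Measure (𝒳 × ℝ))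
    (θ : Param p₁ q) : Matrix (Fin p₁ ⊕ Fin q) (Fin p₁ ⊕ Fin q) ℝ :=
  Matrix.of fun j k => ∫ z, M.info θ z j k ∂ρ

end QuasiModel

/-- The Schur complement `M₂₂ - M₂₁ M₁₁⁻¹ M₁₂` of a matrix in `2 × 2` block form. -/
noncomputable def schur221 {p₁ q : ℕ} (M : Matrix (Fin p₁ ⊕ Fin q) (Fin p₁ ⊕ Fin q) ℝ) :
    Matrix (Fin q) (Fin q) ℝ :=
  M.toBlocks₂₂ - M.toBlocks₂₁ * M.toBlocks₁₁⁻¹ * M.toBlocks₁₂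

open scoped MatrixOrder in
/-- `V^{-1/2}`, the positive semidefinite square root of `V⁻¹`, for a positive definite `V`. -/
noncomputable def invSqrt {ι : Type*} [Fintype ι] [DecidableEq ι] (V : Matrix ι ι ℝ) :
    Matrix ι ι ℝ :=
  CFC.sqrt V⁻¹

/-- A sequence of finite populations drawn from a super-population with law `ρ` for `(X, Y)`, each
with a probability sample. Everything lives on one probability space `(Ω, P)`, so that `P` is the
joint distribution of the super-population model and of the sampling mechanism. The designs are
arbitrary and may be informative. -/
structure SurveySequence {Ω 𝒳 : Type*} [mΩ : MeasurableSpace Ω] [MeasurableSpace 𝒳]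
    (P : Measure Ω) (ρ : Measure (𝒳 × ℝ)) where
  /-- The population sizes `N`. -/
  popSize : ℕ → ℕ
  /-- The values `(xᵢ, yᵢ)` of the units of the populations. -/
  unit : ∀ ν, Fin (popSize ν) → Ω → 𝒳 × ℝ
  /-- The information on the finite population on which the design may depend. It contains the
  values of the units, and may contain further design variables. -/
  frame : ℕ → MeasurableSpace Ω
  /-- The samples `A`. -/
  sample : ∀ ν, Ω → Finset (Fin (popSize ν))
  /-- The first-order inclusion probabilities `πᵢ`. -/
  inclProb : ∀ ν, Fin (popSize ν) → Ω → ℝ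
  frame_le : ∀ ν, frame ν ≤ mΩ
  measurable_unit : ∀ ν i, Measurable[frame ν] (unit ν i)
  map_unit : ∀ ν i, P.map (unit ν i) = ρ
  iIndepFun_unit : ∀ ν, iIndepFun (unit ν) P
  measurableSet_sample : ∀ ν i, MeasurableSet {ω | i ∈ sample ν ω}
  inclProb_pos : ∀ ν i ω, 0 < inclProb ν i ω
  condExp_sample : ∀ ν i,
    P[Set.indicator {ω | i ∈ sample ν ω} (fun _ => (1 : ℝ)) | frame ν] =ᵐ[P] inclProb ν i

namespace SurveySequence

variable {Ω 𝒳 : Type*} [MeasurableSpace Ω] [MeasurableSpace 𝒳] {P : Measure Ω}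
  {ρ : Measure (𝒳 × ℝ)} {p₁ q : ℕ}

/-- The (possibly random) sample size `n = |A|`. -/
def size (D : SurveySequence P ρ) (ν : ℕ) (ω : Ω) : ℝ := ((D.sample ν ω).card : ℝ)

/-- The expected sample size `n₀ = E|A|`; it is `n` if the sample size `n` is not random. -/
noncomputable def expSize (D : SurveySequence P ρ) (ν : ℕ) : ℝ := ∫ ω, D.size ν ω ∂P

/-- The weighted quasi-score `Ŝ_w(θ) = N⁻¹ ∑_{i ∈ A} wᵢ u(θ; xᵢ, yᵢ)`, with `wᵢ = πᵢ⁻¹`. -/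
noncomputable def wScore (D : SurveySequence P ρ) (M : QuasiModel 𝒳 p₁ q) (ν : ℕ) (ω : Ω)
    (θ : Param p₁ q) : Param p₁ q :=
  (D.popSize ν : ℝ)⁻¹ • ∑ i ∈ D.sample ν ω, (D.inclProb ν i ω)⁻¹ • M.score θ (D.unit ν i ω)

/-- The weighted information `Î_w(θ) = N⁻¹ ∑_{i ∈ A} wᵢ I(θ; xᵢ, yᵢ)`, with `wᵢ = πᵢ⁻¹`. -/
noncomputable def wInfo (D : SurveySequence P ρ) (M : QuasiModel 𝒳 p₁ q) (ν : ℕ) (ω : Ω)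
    (θ : Param p₁ q) : Matrix (Fin p₁ ⊕ Fin q) (Fin p₁ ⊕ Fin q) ℝ :=
  (D.popSize ν : ℝ)⁻¹ • ∑ i ∈ D.sample ν ω, (D.inclProb ν i ω)⁻¹ • M.info θ (D.unit ν i ω)

/-- The variance matrix `var{Ŝ_w(θ)}`. -/
noncomputable def varScore (D : SurveySequence P ρ) (M : QuasiModel 𝒳 p₁ q) (ν : ℕ)
    (θ : Param p₁ q) : Matrix (Fin p₁ ⊕ Fin q) (Fin p₁ ⊕ Fin q) ℝ :=
  Matrix.of fun j k => covariance (fun ω => D.wScore M ν ω θ j) (fun ω => D.wScore M ν ω θ k) P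

/-- `t₁` is the solution of the profiled equation `Ŝ_{w1}(θ₁, θ₂) = 0`: it is its one and only
solution with `(θ₁, θ₂) ∈ Θ`. -/
def IsProfileSolution (D : SurveySequence P ρ) (M : QuasiModel 𝒳 p₁ q) (Θ : Set (Param p₁ q))
    (ν : ℕ) (ω : Ω) (θ₂ : Fin q → ℝ) (t₁ : Fin p₁ → ℝ) : Prop :=
  ∀ s₁ : Fin p₁ → ℝ,
    (Sum.elim s₁ θ₂ ∈ Θ ∧ ∀ j, D.wScore M ν ω (Sum.elim s₁ θ₂) (Sum.inl j) = 0) ↔ s₁ = t₁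

/-- The quasi-score statistic `X²_QS(θ₂) = Ŝ_{w2}ᵀ {Î_{w22·1}}⁻¹ Ŝ_{w2}`, evaluated at
`(t₁, θ₂)`, where `t₁` is the profile estimate of `θ₁`. -/
noncomputable def quasiScoreStat (D : SurveySequence P ρ) (M : QuasiModel 𝒳 p₁ q) (ν : ℕ) (ω : Ω)
    (θ₂ : Fin q → ℝ) (t₁ : Fin p₁ → ℝ) : ℝ :=
  let S₂ : Fin q → ℝ := fun j => D.wScore M ν ω (Sum.elim t₁ θ₂) (Sum.inr j)
  S₂ ⬝ᵥ ((schur221 (D.wInfo M ν ω (Sum.elim t₁ θ₂)))⁻¹.mulVec S₂)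

end SurveySequence

/-- `Σ_θ = 𝓘⁻¹ Σ_S (𝓘⁻¹)ᵀ`, the asymptotic variance matrix of `√n (θ̂ - θ₀)`. -/
noncomputable def asymVar {ι : Type*} [Fintype ι] [DecidableEq ι] (I VS : Matrix ι ι ℝ) :
    Matrix ι ι ℝ :=
  I⁻¹ * VS * (I⁻¹).transpose

/-- The law of a vector of independent standard normal variables. -/
noncomputable abbrev stdNormal (ι : Type*) [Fintype ι] : Measure (ι → ℝ) :=
  Measure.pi fun _ => gaussianReal 0 1

/-! Near `θ₀` the weighted score is almost linear with slope `-𝓘`, so `Ŝ(θ̂) ≈ Ŝ(θ₀) - 𝓘 (θ̂ - θ₀)`.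
Apply the row `E = (-𝓘₂₁ 𝓘₁₁⁻¹, 1)`. On the left the first block of `Ŝ(θ̂)` is zero, which leaves
`Ŝ₂(θ̂)`. On the right `E 𝓘 = (0, 𝓘₂₂·₁)`, while under the null hypothesis the second block of `θ̂ -
θ₀` is zero, so the unknown displacement disappears. Hence `n X²` differs from the quadratic form of
`𝓘₂₂·₁⁻¹` in `E √n₀ Ŝ(θ₀)` by a term that vanishes in probability (`tendsto_profile_quadForm`,
`tendstoInMeasure_quasiScoreStat_sub`).

By the central limit theorem and convergence of the variances, `√n₀ Ŝ(θ₀)` has a normal limit with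
variance `Σ_S`. With `R² = 𝓘₂₂·₁⁻¹`, the limiting form is the squared length of a normal vector with
variance `R E Σ_S Eᵀ R`. Diagonalizing this matrix gives the weighted chi-squares, and it has the
characteristic polynomial of `P` because `AB` and `BA` share theirs (`exists_weighted_chiSq`).

Positive definiteness of `𝓘` is derived: the mean is correctly specified, so the residual term of
the information averages out, what remains is a Gram matrix, and an invertible positive semidefinite
matrix is definite (`posSemidef_popInfo`).

Convergence in probability is treated as convergence along the filter `highProb` on `ℕ × Ω`. By
tightness the scaled score may be taken bounded, hence convergent along ultrafilters, and the
expansion becomes a deterministic limit argument. -/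

/-! ### Block algebra of the effective score. -/

section EffectiveScore

open Matrix

variable {p₁ q : ℕ}

/-- The matrix `(-M₂₁ M₁₁⁻¹, 1)` which projects a score onto the effective score for `θ₂`. -/
noncomputable def effRow (M : Matrix (Fin p₁ ⊕ Fin q) (Fin p₁ ⊕ Fin q) ℝ) :
    Matrix (Fin q) (Fin p₁ ⊕ Fin q) ℝ :=
  fromCols (-(M.toBlocks₂₁ * M.toBlocks₁₁⁻¹)) 1

variable {M V : Matrix (Fin p₁ ⊕ Fin q) (Fin p₁ ⊕ Fin q) ℝ}

lemma effRow_mul (h : IsUnit M.toBlocks₁₁) : effRow M * M = fromCols 0 (schur221 M) := by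
  have h' : IsUnit M.toBlocks₁₁.det := (isUnit_iff_isUnit_det _).1 h
  conv_lhs => rw [← fromBlocks_toBlocks M]
  rw [effRow, fromCols_mul_fromBlocks]
  simp only [toBlocks_fromBlocks₂₁, toBlocks_fromBlocks₁₁, Matrix.neg_mul, Matrix.one_mul]
  rw [nonsing_inv_mul_cancel_right _ _ h', schur221]
  congr 1
  · simp
  · abel

lemma schur221_eq (h : IsUnit M.toBlocks₁₁) : schur221 M = effRow M * M * (effRow M)ᵀ := by
  rw [effRow_mul h, effRow, transpose_fromCols, fromCols_mul_fromRows]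
  simp

lemma effRow_vecMul_injective : Function.Injective (effRow M).vecMul := by
  intro v w h
  ext j
  have := congrFun h (Sum.inr j)
  simpa [effRow, vecMul_fromCols] using this

lemma posDef_toBlocks₁₁ (hM : M.PosDef) : M.toBlocks₁₁.PosDef :=
  hM.submatrix Sum.inl_injective

lemma posDef_schur221 (hM : M.PosDef) : (schur221 M).PosDef := by
  rw [schur221_eq (posDef_toBlocks₁₁ hM).isUnit]
  simpa using hM.mul_mul_conjTranspose_same (effRow_vecMul_injective (M := M))

/-- Solving `effRow M * M = (0, schur221 M)` for `effRow M` identifies the second block row of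
`M⁻¹`; this is what links `Σ_θ,22` to the effective score. -/
lemma inv_schur221_mul_effRow (hM : M.PosDef) :
    (schur221 M)⁻¹ * effRow M =
      (fromCols 0 1 : Matrix (Fin q) (Fin p₁ ⊕ Fin q) ℝ) * M⁻¹ := by
  have h1 : IsUnit M.det := (isUnit_iff_isUnit_det _).1 hM.isUnit
  have h2 : IsUnit (schur221 M).det := (isUnit_iff_isUnit_det _).1 (posDef_schur221 hM).isUnit
  have h3 := effRow_mul (posDef_toBlocks₁₁ hM).isUnit
  rw [← mul_nonsing_inv_cancel_right _ (effRow M) h1, h3, ← Matrix.mul_assoc, mul_fromCols,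
    nonsing_inv_mul _ h2, Matrix.mul_zero]

lemma asymVar_toBlocks₂₂ (hM : M.PosDef) :
    (asymVar M V).toBlocks₂₂ =
      ((schur221 M)⁻¹ * effRow M) * V * ((schur221 M)⁻¹ * effRow M)ᵀ := by
  have key (A : Matrix (Fin p₁ ⊕ Fin q) (Fin p₁ ⊕ Fin q) ℝ) : A.toBlocks₂₂ =
      (fromCols 0 1 : Matrix (Fin q) (Fin p₁ ⊕ Fin q) ℝ) * A *
        (fromCols 0 1 : Matrix (Fin q) (Fin p₁ ⊕ Fin q) ℝ)ᵀ := by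
    conv_rhs => rw [← fromBlocks_toBlocks A]
    rw [fromCols_mul_fromBlocks, transpose_fromCols, fromCols_mul_fromRows]
    simp
  rw [inv_schur221_mul_effRow hM, key, asymVar, transpose_mul]
  simp only [Matrix.mul_assoc]

end EffectiveScore

/-! ### Square roots and the spectral theorem. -/

section Spectral

open Matrix

open scoped MatrixOrder in
lemma exists_psd_sq {ι : Type*} [Fintype ι] [DecidableEq ι] {K : Matrix ι ι ℝ} (hK : K.PosDef) :
    ∃ D : Matrix ι ι ℝ, Dᵀ = D ∧ D * D = K := by
  refine ⟨CFC.sqrt K, ?_, CFC.sqrt_mul_sqrt_self K hK.posSemidef.nonneg⟩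
  have := (CFC.sqrt_nonneg K).posSemidef.isHermitian
  simpa [IsHermitian] using this

/-- The spectral theorem for positive definite matrices, with sorted eigenvalues. -/
lemma exists_sorted_spectral {q : ℕ} {A : Matrix (Fin q) (Fin q) ℝ} (hA : A.PosDef) :
    ∃ (c : Fin q → ℝ) (U : Matrix (Fin q) (Fin q) ℝ), Antitone c ∧ (∀ i, 0 < c i) ∧
      Uᵀ * U = 1 ∧ A = U * diagonal c * Uᵀ ∧
      A.charpoly = ∏ i, (Polynomial.X - Polynomial.C (c i)) := by
  set e := hA.isHermitian.eigenvalues with he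
  set U₀ : Matrix (Fin q) (Fin q) ℝ := hA.isHermitian.eigenvectorUnitary.1 with hU₀
  have h1 : U₀ᵀ * U₀ = 1 := by
    have := Unitary.coe_star_mul_self hA.isHermitian.eigenvectorUnitary
    simpa [star_eq_conjTranspose] using this
  have h2 : A = U₀ * diagonal e * U₀ᵀ := by
    have := hA.isHermitian.spectral_theorem
    rw [Unitary.conjStarAlgAut_apply] at this
    simpa [star_eq_conjTranspose, Function.comp_def] using this
  -- Sorting the negated eigenvalues increasingly puts the eigenvalues in decreasing order.
  set σ : Equiv.Perm (Fin q) := Tuple.sort (fun i => -e i) with hσ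
  have hmono : Monotone ((fun i => -e i) ∘ σ) := Tuple.monotone_sort _
  refine ⟨e ∘ σ, U₀.submatrix id σ, ?_, fun i => hA.eigenvalues_pos _, ?_, ?_, ?_⟩
  · intro i j hij
    have := hmono hij
    simpa using this
  · have : (U₀.submatrix id σ)ᵀ * U₀.submatrix id σ = (U₀ᵀ * U₀).submatrix σ σ := by
      ext i j; simp [mul_apply]
    rw [this, h1, submatrix_one_equiv]
  · have : diagonal (e ∘ σ) = (diagonal e).submatrix σ σ := by
      rw [submatrix_diagonal_equiv]
    rw [this, transpose_submatrix, submatrix_mul_equiv, submatrix_mul_equiv]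
    simpa using h2
  · rw [hA.isHermitian.charpoly_eq]
    exact (Equiv.prod_comp σ fun i => Polynomial.X - Polynomial.C (e i)).symm

end Spectral

/-! ### Linear images of standard normal vectors. -/

section GaussianImage

open Matrix

lemma charFunDual_stdNormal {ι : Type*} [Fintype ι] [DecidableEq ι] (L : StrongDual ℝ (ι → ℝ)) :
    charFunDual (stdNormal ι) L =
      Complex.exp (-((∑ i, L (Pi.single i 1) ^ 2 : ℝ) : ℂ) / 2) := by
  have h1 (ℓ : StrongDual ℝ ℝ) :
      charFunDual (gaussianReal 0 1) ℓ = Complex.exp (-((ℓ 1 ^ 2 : ℝ) : ℂ) / 2) := by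
    rw [charFunDual_eq_charFun_map_one]
    have : (ℓ : ℝ → ℝ) = fun x => ℓ 1 * x := by
      ext x
      have := ℓ.map_smul x 1
      rw [smul_eq_mul, smul_eq_mul, mul_one] at this
      rw [this, mul_comm]
    rw [this, gaussianReal_map_const_mul, charFun_gaussianReal]
    simp
    ring_nf
  rw [charFunDual_pi]
  simp only [h1]
  rw [← Complex.exp_sum]
  congr 1
  push_cast
  rw [← Finset.sum_neg_distrib, Finset.sum_div]
  rfl

/-- The point of this form is that `A` enters only through `A * Aᵀ`, so the covariance determines
the law. -/
lemma charFunDual_map_mulVec_stdNormal {m ι : Type*} [Fintype m] [DecidableEq m] [Fintype ι]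
    (A : Matrix m ι ℝ) (L : StrongDual ℝ (m → ℝ)) :
    charFunDual ((stdNormal ι).map A.mulVec) L = Complex.exp
      (-((∑ i, ∑ j, L (Pi.single i 1) * L (Pi.single j 1) * (A * Aᵀ) i j : ℝ) : ℂ) / 2) := by
  classical
  have h1 : A.mulVec =
      ((LinearMap.toContinuousLinearMap A.mulVecLin : (ι → ℝ) →L[ℝ] (m → ℝ)) :
        (ι → ℝ) → (m → ℝ)) := by
    ext; simp
  rw [h1, charFunDual_map, charFunDual_stdNormal]
  have h2 (i : ι) : (L ∘SL (LinearMap.toContinuousLinearMap A.mulVecLin)) (Pi.single i 1) =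
      ∑ j, L (Pi.single j 1) * A j i := by
    simp only [ContinuousLinearMap.comp_apply, LinearMap.coe_toContinuousLinearMap',
      mulVecLin_apply, mulVec_single_one]
    conv_lhs => rw [pi_eq_sum_univ' (A.col i)]
    rw [map_sum]
    refine Finset.sum_congr rfl fun j _ => ?_
    rw [map_smul, smul_eq_mul, mul_comm]
    congr 2
  simp only [h2]
  congr 4
  simp_rw [sq, Finset.sum_mul_sum, mul_apply, transpose_apply, Finset.mul_sum]
  rw [Finset.sum_comm]
  refine Finset.sum_congr rfl fun i _ => ?_
  rw [Finset.sum_comm]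
  refine Finset.sum_congr rfl fun j _ => Finset.sum_congr rfl fun k _ => ?_
  ring

/-- Linear images of standard normal vectors with the same covariance have the same law. -/
lemma map_mulVec_stdNormal_eq {m ι κ : Type*} [Fintype m] [Fintype ι] [Fintype κ]
    {A : Matrix m ι ℝ} {B : Matrix m κ ℝ} (h : A * Aᵀ = B * Bᵀ) :
    (stdNormal ι).map A.mulVec = (stdNormal κ).map B.mulVec := by
  classical
  have hA : IsProbabilityMeasure ((stdNormal ι).map A.mulVec) :=
    Measure.isProbabilityMeasure_map (by fun_prop)
  have hB : IsProbabilityMeasure ((stdNormal κ).map B.mulVec) :=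
    Measure.isProbabilityMeasure_map (by fun_prop)
  refine Measure.ext_of_charFunDual ?_
  ext L
  rw [charFunDual_map_mulVec_stdNormal, charFunDual_map_mulVec_stdNormal, h]

end GaussianImage

/-! ### Limits of inverses and square roots of matrices. -/

section MatrixLimits

open Matrix

variable {ι : Type*} [Fintype ι]

/-- Compactness of the unit sphere: unit vectors at which matrices tending to `A` fail to be
positive would converge along an ultrafilter to a unit vector at which `A` fails. Symmetry is a
premise since matrices near `A` need not be symmetric. -/
lemma eventually_posDef {A : Matrix ι ι ℝ} (hA : A.PosDef) :
    ∀ᶠ W in 𝓝 A, W.IsHermitian → W.PosDef := by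
  by_contra hcon
  rw [not_eventually] at hcon
  have hx (W : Matrix ι ι ℝ) : ∃ x : ι → ℝ, ¬ (W.IsHermitian → W.PosDef) →
      x ∈ Metric.sphere (0 : ι → ℝ) 1 ∧ x ⬝ᵥ W *ᵥ x ≤ 0 := by
    by_cases h : W.IsHermitian → W.PosDef
    · exact ⟨0, fun h' => (h' h).elim⟩
    push Not at h
    have h2 : ∃ x : ι → ℝ, x ≠ 0 ∧ x ⬝ᵥ W *ᵥ x ≤ 0 := by
      by_contra! h3
      exact h.2 (PosDef.of_dotProduct_mulVec_pos h.1 fun x hx => by simpa using h3 x hx)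
    obtain ⟨x, hx0, hx1⟩ := h2
    refine ⟨‖x‖⁻¹ • x, fun _ => ⟨?_, ?_⟩⟩
    · simp [norm_smul, hx0]
    · rw [mulVec_smul, smul_dotProduct, dotProduct_smul, smul_smul, smul_eq_mul]
      exact mul_nonpos_of_nonneg_of_nonpos (by positivity) hx1
  choose x hx using hx
  obtain ⟨u, hu⟩ := @Ultrafilter.exists_le _ (𝓝 A ⊓ 𝓟 {W | ¬ (W.IsHermitian → W.PosDef)})
    (frequently_iff_neBot.1 hcon)
  have hu1 : Tendsto id (u : Filter (Matrix ι ι ℝ)) (𝓝 A) := hu.trans inf_le_left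
  have hu2 : ∀ᶠ W in (u : Filter (Matrix ι ι ℝ)), ¬ (W.IsHermitian → W.PosDef) :=
    hu (mem_inf_of_right (mem_principal_self _))
  obtain ⟨x₀, hx₀, hlim⟩ := (isCompact_sphere (0 : ι → ℝ) 1).ultrafilter_le_nhds (u.map x)
    (le_principal_iff.2 (mem_map.2 (hu2.mono fun W hW => (hx W hW).1)))
  have hlim : Tendsto x u (𝓝 x₀) := hlim
  have hq : Tendsto (fun W => x W ⬝ᵥ W *ᵥ x W) u (𝓝 (x₀ ⬝ᵥ A *ᵥ x₀)) := by
    have hc : Continuous fun y : (ι → ℝ) × Matrix ι ι ℝ => y.1 ⬝ᵥ y.2 *ᵥ y.1 := by fun_prop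
    exact (hc.tendsto (x₀, A)).comp (hlim.prodMk_nhds hu1)
  have h1 : x₀ ⬝ᵥ A *ᵥ x₀ ≤ 0 := le_of_tendsto hq (hu2.mono fun W hW => (hx W hW).2)
  have h2 : x₀ ≠ 0 := by
    rintro rfl
    simp at hx₀
  have := hA.dotProduct_mulVec_pos h2
  simp only [star_trivial] at this
  linarith

variable [DecidableEq ι]

lemma tendsto_matrix_inv {α : Type*} {l : Filter α} {f : α → Matrix ι ι ℝ} {A : Matrix ι ι ℝ}
    (hf : Tendsto f l (𝓝 A)) (hA : IsUnit A) : Tendsto (fun a => (f a)⁻¹) l (𝓝 A⁻¹) := by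
  have h : A.det ≠ 0 := ((isUnit_iff_isUnit_det _).1 hA).ne_zero
  simp only [inv_def, Ring.inverse_eq_inv']
  have h1 : Tendsto (fun a => (f a).det) l (𝓝 A.det) :=
    (continuous_id.matrix_det.tendsto A).comp hf
  have h2 : Tendsto (fun a => (f a).adjugate) l (𝓝 A.adjugate) :=
    (continuous_id.matrix_adjugate.tendsto A).comp hf
  exact (h1.inv₀ h).smul h2

open scoped MatrixOrder in
/-- Continuity of the square root at a positive definite matrix. -/
lemma tendsto_of_sq_tendsto {α : Type*} {l : Filter α} {G : α → Matrix ι ι ℝ} {K : Matrix ι ι ℝ}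
    (hG : ∀ᶠ a in l, (G a).PosSemidef) (hlim : Tendsto (fun a => G a * G a) l (𝓝 K)) :
    Tendsto G l (𝓝 (CFC.sqrt K)) := by
  rw [tendsto_iff_ultrafilter]
  intro u hu
  have hK : Tendsto (fun a => ∑ i, (G a * G a) i i) u (𝓝 (∑ i, K i i)) :=
    tendsto_finsetSum _ fun i _ => ((continuous_id.matrix_elem i i).tendsto K).comp
      (hlim.mono_left hu)
  set C := (∑ i, K i i) + 1
  have hC : ∀ᶠ a in (u : Filter α), ∑ i, (G a * G a) i i < C :=
    hK.eventually_lt_const (lt_add_one _)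
  have hG' : ∀ᶠ a in (u : Filter α), (G a).PosSemidef := hu hG
  -- For symmetric `G` each squared entry is at most the trace of `G * G`; these traces converge, so
  -- the entries stay in a compact box.
  have hmem : ∀ᶠ a in (u : Filter α), G a ∈
      (Set.univ.pi fun _ => Set.univ.pi fun _ => Set.Icc (-(C + 1)) (C + 1) :
        Set (ι → ι → ℝ)) := by
    filter_upwards [hC, hG'] with a ha hpsd i _ j _
    have hsym (i j) : G a j i = G a i j := by simpa using hpsd.isHermitian.apply i j
    have h1 : G a i j ^ 2 ≤ ∑ i, (G a * G a) i i := by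
      simp only [mul_apply]
      calc G a i j ^ 2 = G a i j * G a j i := by rw [hsym, sq]
        _ ≤ ∑ j, G a i j * G a j i := Finset.single_le_sum (f := fun j => G a i j * G a j i)
            (fun k _ => by rw [hsym i k]; exact mul_self_nonneg _) (Finset.mem_univ j)
        _ ≤ _ := Finset.single_le_sum (f := fun i => ∑ j, G a i j * G a j i)
            (fun k _ => Finset.sum_nonneg fun k' _ => by
              rw [hsym k k']; exact mul_self_nonneg _) (Finset.mem_univ i)
    constructor <;> nlinarith [sq_nonneg (G a i j - 1), sq_nonneg (G a i j + 1)]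
  obtain ⟨(G₀ : Matrix ι ι ℝ), -, hG₀⟩ := (isCompact_univ_pi fun _ : ι => isCompact_univ_pi fun _ : ι =>
    isCompact_Icc).ultrafilter_le_nhds (u.map G) (le_principal_iff.2 (mem_map.2 hmem))
  have hG₀ : Tendsto G u (𝓝 G₀) := hG₀
  have h1 : G₀ * G₀ = K :=
    tendsto_nhds_unique (X := Matrix ι ι ℝ) (hG₀.mul hG₀) (hlim.mono_left hu)
  have h2 : G₀.PosSemidef := by
    refine PosSemidef.of_dotProduct_mulVec_nonneg ?_ fun x => ?_
    · have : Tendsto (fun a => (G a)ᴴ) u (𝓝 G₀ᴴ) :=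
        (continuous_id.matrix_conjTranspose.tendsto G₀).comp hG₀
      exact tendsto_nhds_unique (this.congr' (hG'.mono fun a ha => ha.isHermitian.eq)) hG₀
    · have hc : Continuous fun y : Matrix ι ι ℝ => star x ⬝ᵥ y *ᵥ x := by fun_prop
      exact ge_of_tendsto ((hc.tendsto G₀).comp hG₀)
        (hG'.mono fun a ha => ha.dotProduct_mulVec_nonneg x)
  -- Uniqueness of the positive semidefinite root makes all ultrafilter limits agree.
  rw [CFC.sqrt_unique h1 h2.nonneg]
  exact hG₀

open scoped MatrixOrder in
/-- Unstudentizing: if `s V → W`, then `√s` times a vector is the image of the vector standardized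
by `V^{-1/2}` under a matrix which converges to a square root of `W`. -/
lemma exists_tendsto_mul_invSqrt {V : ℕ → Matrix ι ι ℝ} {s : ℕ → ℝ} {W : Matrix ι ι ℝ}
    (hs : Tendsto s atTop atTop) (hV : Tendsto (fun n => s n • V n) atTop (𝓝 W)) (hW : W.PosDef)
    (hsym : ∀ n, (V n)ᵀ = V n) :
    ∃ (H : Matrix ι ι ℝ) (A : ℕ → Matrix ι ι ℝ), H * Hᵀ = W ∧ Tendsto A atTop (𝓝 H) ∧
      ∀ᶠ n in atTop, A n * invSqrt (V n) = √(s n) • (1 : Matrix ι ι ℝ) := by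
  have hW' : W⁻¹.PosDef := hW.inv
  -- Eventually `G n` is the positive semidefinite root of `(s n • V n)⁻¹`, so it tends to the root
  -- of `W⁻¹`. The inverses of `G n` and of this limit serve as `A n` and `H`.
  set G : ℕ → Matrix ι ι ℝ := fun n => (√(s n))⁻¹ • invSqrt (V n) with hGdef
  have hpd : ∀ᶠ n in atTop, 0 < s n ∧ (V n).PosDef := by
    filter_upwards [hs.eventually_gt_atTop 0, hV.eventually (eventually_posDef hW)] with n h0 h1
    have h2 := h1 (by simp [IsHermitian, hsym])
    refine ⟨h0, ?_⟩
    have := h2.smul (inv_pos.2 h0)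
    rwa [smul_smul, inv_mul_cancel₀ h0.ne', one_smul] at this
  have hsqrt : (CFC.sqrt W⁻¹) * (CFC.sqrt W⁻¹) = W⁻¹ :=
    CFC.sqrt_mul_sqrt_self _ hW'.posSemidef.nonneg
  have hsq : ∀ᶠ n in atTop, (s n • V n)⁻¹ = G n * G n := by
    filter_upwards [hpd] with n hn
    have h1 : invSqrt (V n) * invSqrt (V n) = (V n)⁻¹ :=
      CFC.sqrt_mul_sqrt_self _ hn.2.inv.posSemidef.nonneg
    have h2 : IsUnit (V n).det := (isUnit_iff_isUnit_det _).1 hn.2.isUnit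
    rw [hGdef]
    simp only [smul_mul_smul_comm, h1]
    rw [← mul_inv, Real.mul_self_sqrt hn.1.le]
    refine inv_eq_left_inv ?_
    rw [smul_mul_smul_comm, inv_mul_cancel₀ hn.1.ne', one_smul, nonsing_inv_mul _ h2]
  have hGpsd : ∀ᶠ n in atTop, (G n).PosSemidef :=
    Eventually.of_forall fun n => (CFC.sqrt_nonneg _).posSemidef.smul (by positivity)
  have hGlim : Tendsto G atTop (𝓝 (CFC.sqrt W⁻¹)) :=
    tendsto_of_sq_tendsto hGpsd ((tendsto_matrix_inv hV hW.isUnit).congr' hsq)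
  have hunit : IsUnit (CFC.sqrt W⁻¹) := by
    rw [isUnit_iff_isUnit_det]
    have : IsUnit (CFC.sqrt W⁻¹ * CFC.sqrt W⁻¹).det := by
      rw [hsqrt]
      exact (isUnit_iff_isUnit_det _).1 hW'.isUnit
    rw [det_mul] at this
    exact isUnit_of_mul_isUnit_left this
  have hH : (CFC.sqrt W⁻¹)ᵀ = CFC.sqrt W⁻¹ := by
    simpa [IsHermitian] using (CFC.sqrt_nonneg W⁻¹).posSemidef.isHermitian
  refine ⟨(CFC.sqrt W⁻¹)⁻¹, fun n => (G n)⁻¹, ?_, tendsto_matrix_inv hGlim hunit, ?_⟩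
  · rw [transpose_nonsing_inv, hH, ← Matrix.mul_inv_rev, hsqrt, nonsing_inv_nonsing_inv]
    exact (isUnit_iff_isUnit_det _).1 hW.isUnit
  · filter_upwards [hpd, hsq] with n hn hsqn
    have h1 : IsUnit (G n).det := by
      have : IsUnit (G n * G n).det := by
        rw [← hsqn]
        exact (isUnit_iff_isUnit_det _).1 (hn.2.smul hn.1).inv.isUnit
      rw [det_mul] at this
      exact isUnit_of_mul_isUnit_left this
    have h2 : invSqrt (V n) = √(s n) • G n := by
      rw [hGdef]
      simp only [smul_smul]
      rw [mul_inv_cancel₀ (Real.sqrt_pos.2 hn.1).ne', one_smul]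
    rw [h2, Matrix.mul_smul, nonsing_inv_mul _ h1]

end MatrixLimits

/-! ### Convergence in probability as convergence along a filter. -/

section HighProbability

variable {Ω : Type*} [MeasurableSpace Ω]

/-- The filter of the events which hold with probability tending to one. -/
def highProb (P : Measure Ω) : Filter (ℕ × Ω) where
  sets := {S | Tendsto (fun n => P {ω | (n, ω) ∉ S}) atTop (𝓝 0)}
  univ_sets := by simp
  sets_of_superset {S T} hS hST := tendsto_of_tendsto_of_tendsto_of_le_of_le tendsto_const_nhds hS
    (fun _ => zero_le) fun _ => measure_mono fun _ h h' => h (hST h')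
  inter_sets {S T} hS hT := by
    have hS : Tendsto (fun n => P {ω | (n, ω) ∉ S}) atTop (𝓝 0) := hS
    have hT : Tendsto (fun n => P {ω | (n, ω) ∉ T}) atTop (𝓝 0) := hT
    have h := hS.add hT
    rw [add_zero] at h
    refine tendsto_of_tendsto_of_tendsto_of_le_of_le tendsto_const_nhds h (fun _ => zero_le)
      fun n => (measure_mono ?_).trans (measure_union_le _ _)
    intro ω hω
    by_contra hc
    simp only [Set.mem_union, Set.mem_ofPred_eq, not_or, not_not] at hc
    exact hω hc

variable {P : Measure Ω}

lemma eventually_highProb {p : ℕ × Ω → Prop} :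
    (∀ᶠ a in highProb P, p a) ↔ Tendsto (fun n => P {ω | ¬ p (n, ω)}) atTop (𝓝 0) :=
  Iff.rfl

lemma tendsto_fst_highProb : Tendsto Prod.fst (highProb P) atTop := by
  intro S hS
  change Tendsto (fun n => P {ω | ¬ n ∈ S}) atTop (𝓝 0)
  refine tendsto_const_nhds.congr' ?_
  filter_upwards [hS] with n hn
  simp [hn]

lemma tendsto_highProb_of_tendstoInMeasure {f : ℕ → Ω → ℝ} {c : ℝ}
    (h : TendstoInMeasure P f atTop fun _ => c) :
    Tendsto (fun a : ℕ × Ω => f a.1 a.2) (highProb P) (𝓝 c) := by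
  rw [tendstoInMeasure_iff_dist] at h
  rw [Metric.tendsto_nhds]
  intro ε hε
  rw [eventually_highProb]
  simpa using h ε hε

lemma tendstoInMeasure_of_tendsto_highProb {f : ℕ → Ω → ℝ}
    (h : Tendsto (fun a : ℕ × Ω => f a.1 a.2) (highProb P) (𝓝 0)) :
    TendstoInMeasure P f atTop 0 := by
  rw [tendstoInMeasure_iff_dist]
  rw [Metric.tendsto_nhds] at h
  intro ε hε
  simpa [eventually_highProb] using h ε hε

/-- A sequence which converges in distribution is tight: for properties which hold with
probability tending to one, it may be taken to be bounded. -/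
lemma eventually_highProb_of_tight [IsProbabilityMeasure P] {E Ω' : Type*} [NormedAddCommGroup E]
    [MeasurableSpace E] [BorelSpace E] [MeasurableSpace Ω'] {μ : Measure Ω'}
    [IsProbabilityMeasure μ] {R : ℕ → Ω → E} {Z : Ω' → E}
    (hR : TendstoInDistribution R atTop Z (fun _ => P) μ) {p : ℕ × Ω → Prop}
    (hp : ∀ K : ℝ, ∀ᶠ a in highProb P, ‖R a.1 a.2‖ ≤ K → p a) : ∀ᶠ a in highProb P, p a := by
  rw [eventually_highProb, ENNReal.tendsto_nhds_zero]
  intro ε hε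
  have hε2 : 0 < ε / 2 := ENNReal.half_pos hε.ne'
  have hprob : IsProbabilityMeasure (μ.map Z) :=
    Measure.isProbabilityMeasure_map hR.aemeasurable_limit
  -- The tail sets of the limit law decrease to the empty set; being closed, they obey the
  -- portmanteau bound, which transfers the estimate to `R n` for large `n`.
  obtain ⟨K, hK⟩ : ∃ K : ℕ, μ.map Z {x | (K : ℝ) ≤ ‖x‖} < ε / 2 := by
    have h := tendsto_measure_iInter_atTop (μ := μ.map Z)
      (s := fun K : ℕ => {x : E | (K : ℝ) ≤ ‖x‖})
      (fun K => (isClosed_le continuous_const continuous_norm).measurableSet.nullMeasurableSet)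
      (fun i j hij x (hx : (j : ℝ) ≤ ‖x‖) =>
        show (i : ℝ) ≤ ‖x‖ from le_trans (by exact_mod_cast hij) hx) ⟨0, measure_ne_top _ _⟩
    have h0 : ⋂ K : ℕ, {x : E | (K : ℝ) ≤ ‖x‖} = ∅ := by
      ext x
      obtain ⟨K, hK⟩ := exists_nat_gt ‖x‖
      simp only [Set.mem_iInter, Set.mem_ofPred_eq, Set.mem_empty_iff_false, iff_false, not_forall,
        not_le]
      exact ⟨K, hK⟩
    rw [h0, measure_empty] at h
    exact (h.eventually_lt_const hε2).exists
  have hlim := ProbabilityMeasure.limsup_measure_closed_le_of_tendsto hR.tendsto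
    (F := {x : E | (K : ℝ) ≤ ‖x‖}) (isClosed_le continuous_const continuous_norm)
  have h1 := eventually_lt_of_limsup_lt (hlim.trans_lt hK)
  have h2 := (ENNReal.tendsto_nhds_zero.1 (eventually_highProb.1 (hp K))) (ε / 2) hε2
  filter_upwards [h1, h2] with n hn1 hn2
  have hn1' : P {ω | (K : ℝ) ≤ ‖R n ω‖} < ε / 2 := by
    refine lt_of_eq_of_lt ?_ hn1
    exact (Measure.map_apply_of_aemeasurable (hR.forall_aemeasurable n)
      (isClosed_le continuous_const continuous_norm).measurableSet).symm
  calc P {ω | ¬ p (n, ω)} ≤ P ({ω | ¬ (‖R n ω‖ ≤ K → p (n, ω))} ∪ {ω | (K : ℝ) ≤ ‖R n ω‖}) := by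
        refine measure_mono fun ω hω => ?_
        rcases le_total ‖R n ω‖ K with h | h
        · exact Or.inl fun h' => hω (h' h)
        · exact Or.inr h
    _ ≤ ε / 2 + ε / 2 := (measure_union_le _ _).trans (add_le_add hn2 hn1'.le)
    _ = ε := ENNReal.add_halves ε

end HighProbability

/-! ### Nearly linear functions and their roots. -/

section UniformLinearization

variable {α E F : Type*} {l : Filter α} [NormedAddCommGroup E] [NormedSpace ℝ E]
  [NormedAddCommGroup F] [NormedSpace ℝ F]

/-- Functions whose derivatives converge to `φ` jointly in the index and at `x₀` are uniformly
close to the linear function `φ` near `x₀`. -/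
lemma exists_approximatesLinearOn {f : α → E → F} {f' : α → E → E →L[ℝ] F} {φ : E →L[ℝ] F}
    {x₀ : E} (hf : ∀ᶠ x in l ×ˢ 𝓝 x₀, HasFDerivAt (f x.1) (f' x.1 x.2) x.2)
    (hlim : Tendsto (fun x : α × E => f' x.1 x.2) (l ×ˢ 𝓝 x₀) (𝓝 φ)) {c : NNReal} (hc : 0 < c) :
    ∃ r > 0, ∀ᶠ a in l, ApproximatesLinearOn (f a) φ (Metric.closedBall x₀ r) c := by
  have h := hf.and (hlim.eventually (Metric.closedBall_mem_nhds φ (NNReal.coe_pos.2 hc)))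
  obtain ⟨p, hp, s, hs, hps⟩ := eventually_prod_iff.1 h
  obtain ⟨r, hr, hrs⟩ := Metric.nhds_basis_closedBall.eventually_iff.1 hs
  refine ⟨r, hr, hp.mono fun a ha x hx y hy => ?_⟩
  exact (convex_closedBall x₀ r).norm_image_sub_le_of_norm_hasFDerivWithin_le'
    (f' := f' a) (fun z hz => (hps ha (hrs hz)).1.hasFDerivWithinAt)
    (fun z hz => by simpa [dist_eq_norm] using (hps ha (hrs hz)).2) hy hx

/-- A quantitative inverse function argument, uniform in the index: a function close to a surjective
linear map sends a ball around `x₀` onto a ball of proportional radius around `g a x₀`, which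
reaches `0` as soon as `g a x₀` is small. -/
lemma exists_root_near [CompleteSpace E] {g : α → E → F} {φ : E →L[ℝ] F} {ψ : F →L[ℝ] E} {x₀ : E}
    (hψ : ∀ y, φ (ψ y) = y)
    (hg : ∀ c : NNReal, 0 < c →
      ∃ r > 0, ∀ᶠ a in l, ApproximatesLinearOn (g a) φ (Metric.closedBall x₀ r) c)
    (hlim : Tendsto (fun a => g a x₀) l (𝓝 0)) :
    ∃ C : ℝ, 0 ≤ C ∧ ∀ᶠ a in l, ∃ x, ‖x - x₀‖ ≤ C * ‖g a x₀‖ ∧ g a x = 0 := by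
  -- The added `1` keeps the constant positive even if `ψ = 0`.
  let N : φ.NonlinearRightInverse := ⟨ψ, ‖ψ‖₊ + 1, fun y => by
    refine (ψ.le_opNorm y).trans (mul_le_mul_of_nonneg_right ?_ (norm_nonneg _))
    simp, hψ⟩
  have hN : 0 < (N.nnnorm : ℝ) := by
    change 0 < ((‖ψ‖₊ + 1 : NNReal) : ℝ)
    positivity
  -- With this slope error a ball of radius `s` covers one of radius `s / (2 * N.nnnorm)`, whence
  -- the constant `2 * N.nnnorm` in the bound.
  obtain ⟨r, hr, hev⟩ := hg (N.nnnorm⁻¹ / 2) (by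
    have : 0 < N.nnnorm := NNReal.coe_pos.1 hN
    positivity)
  have hsmall : Tendsto (fun a => 2 * N.nnnorm * ‖g a x₀‖) l (𝓝 0) := by
    simpa using hlim.norm.const_mul (2 * (N.nnnorm : ℝ))
  refine ⟨2 * N.nnnorm, by positivity, ?_⟩
  filter_upwards [hev, hsmall.eventually_le_const hr] with a ha har
  have hsurj := ha.surjOn_closedBall_of_nonlinearRightInverse N (by positivity)
    (Metric.closedBall_subset_closedBall har)
  have h0 : (0 : F) ∈ Metric.closedBall (g a x₀)
      (((N.nnnorm : ℝ)⁻¹ - (N.nnnorm⁻¹ / 2 : NNReal)) * (2 * N.nnnorm * ‖g a x₀‖)) := by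
    rw [Metric.mem_closedBall, dist_zero_left]
    push_cast
    refine le_of_eq ?_
    field_simp
    ring
  obtain ⟨x, hx, hx0⟩ := hsurj h0
  exact ⟨x, by simpa [dist_eq_norm] using hx, hx0⟩

end UniformLinearization

/-! ### Expansion of the score at the profile estimate. -/

section ProfileScore

open Matrix

variable {p₁ q : ℕ} {α : Type*} {l : Filter α}

/-- The linear map from matrices to continuous linear maps. -/
noncomputable def mulVecCLM {m n : Type*} [Fintype m] [Fintype n] [DecidableEq n] :
    Matrix m n ℝ →ₗ[ℝ] ((n → ℝ) →L[ℝ] (m → ℝ)) :=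
  (LinearMap.toContinuousLinearMap (𝕜 := ℝ) (E := n → ℝ) (F' := m → ℝ)).toLinearMap ∘ₗ
    (Matrix.toLin' (R := ℝ) (m := m) (n := n)).toLinearMap

lemma tendsto_matrix_mul {k m n : Type*} [Fintype m] {f : α → Matrix k m ℝ} {g : α → Matrix m n ℝ}
    {A : Matrix k m ℝ} {B : Matrix m n ℝ} (hf : Tendsto f l (𝓝 A)) (hg : Tendsto g l (𝓝 B)) :
    Tendsto (fun a => f a * g a) l (𝓝 (A * B)) :=
  ((continuous_fst.matrix_mul continuous_snd).tendsto (A, B)).comp (hf.prodMk_nhds hg)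

@[simp]
lemma mulVecCLM_apply {m n : Type*} [Fintype m] [Fintype n] [DecidableEq n] (A : Matrix m n ℝ)
    (v : n → ℝ) : mulVecCLM A v = A *ᵥ v := by
  simp [mulVecCLM]

lemma continuous_mulVecCLM {m n : Type*} [Fintype m] [Fintype n] [DecidableEq n] :
    Continuous (mulVecCLM : Matrix m n ℝ →ₗ[ℝ] ((n → ℝ) →L[ℝ] (m → ℝ))) :=
  LinearMap.continuous_of_finiteDimensional _

lemma norm_elim_zero (x : Fin p₁ → ℝ) : ‖(Sum.elim x 0 : Param p₁ q)‖ = ‖x‖ := by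
  refine le_antisymm ((pi_norm_le_iff_of_nonneg (norm_nonneg _)).2 ?_)
    ((pi_norm_le_iff_of_nonneg (norm_nonneg _)).2 fun i => ?_)
  · rintro (i | i)
    · exact norm_le_pi_norm x i
    · simp
  · exact norm_le_pi_norm (Sum.elim x 0 : Param p₁ q) (Sum.inl i)

lemma elim_sub_elim (x y : Fin p₁ → ℝ) (θ₂ : Fin q → ℝ) :
    (Sum.elim x θ₂ - Sum.elim y θ₂ : Param p₁ q) = Sum.elim (x - y) 0 := by
  ext (i | i) <;> simp

lemma norm_comp_inl_le (v : Param p₁ q) : ‖fun j => v (Sum.inl j)‖ ≤ ‖v‖ :=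
  (pi_norm_le_iff_of_nonneg (norm_nonneg _)).2 fun i => norm_le_pi_norm v (Sum.inl i)

variable {S : α → Param p₁ q → Param p₁ q}
  {J : α → Param p₁ q → Matrix (Fin p₁ ⊕ Fin q) (Fin p₁ ⊕ Fin q) ℝ}
  {I₀ : Matrix (Fin p₁ ⊕ Fin q) (Fin p₁ ⊕ Fin q) ℝ} {θ₁ : Fin p₁ → ℝ} {θ₂ : Fin q → ℝ}
  {Θ : Set (Param p₁ q)} {m : α → ℝ} {r : Param p₁ q} {t : α → Fin p₁ → ℝ}

/-- The profile estimate is close to the true value, by the order of the score. -/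
lemma exists_profile_bound (hI : I₀.PosDef)
    (hS : ∀ c : NNReal, 0 < c → ∃ ε > 0, ∀ᶠ a in l, ApproximatesLinearOn (S a) (-mulVecCLM I₀)
      (Metric.closedBall (Sum.elim θ₁ θ₂) ε) c)
    (hΘ : Θ ∈ 𝓝 (Sum.elim θ₁ θ₂ : Param p₁ q))
    (hlim : Tendsto (fun a => S a (Sum.elim θ₁ θ₂)) l (𝓝 0))
    (ht : ∀ᶠ a in l, ∀ s₁ : Fin p₁ → ℝ, (Sum.elim s₁ θ₂ ∈ Θ ∧
      ∀ j, S a (Sum.elim s₁ θ₂) (Sum.inl j) = 0) ↔ s₁ = t a) :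
    ∃ C : ℝ, 0 ≤ C ∧ ∀ᶠ a in l, ‖t a - θ₁‖ ≤ C * ‖S a (Sum.elim θ₁ θ₂)‖ := by
  have hI' : IsUnit I₀.toBlocks₁₁.det :=
    (isUnit_iff_isUnit_det _).1 (posDef_toBlocks₁₁ hI).isUnit
  set g : α → (Fin p₁ → ℝ) → (Fin p₁ → ℝ) := fun a x j => S a (Sum.elim x θ₂) (Sum.inl j)
  have hg0 : Tendsto (fun a => g a θ₁) l (𝓝 0) :=
    squeeze_zero_norm (fun a => norm_comp_inl_le _) (tendsto_norm_zero.comp hlim)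
  obtain ⟨C, hC, hroot⟩ := exists_root_near (l := l) (g := g) (x₀ := θ₁)
    (φ := -mulVecCLM I₀.toBlocks₁₁) (ψ := -mulVecCLM I₀.toBlocks₁₁⁻¹)
    (fun y => by simp [mulVec_mulVec, mul_nonsing_inv _ hI', mulVec_neg]) (fun c hc => by
      obtain ⟨ε, hε, hev⟩ := hS c hc
      refine ⟨ε, hε, hev.mono fun a ha x hx y hy => ?_⟩
      have hmem (x : Fin p₁ → ℝ) (hx : x ∈ Metric.closedBall θ₁ ε) :
          (Sum.elim x θ₂ : Param p₁ q) ∈ Metric.closedBall (Sum.elim θ₁ θ₂) ε := by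
        rw [Metric.mem_closedBall, dist_eq_norm] at hx ⊢
        rwa [elim_sub_elim, norm_elim_zero]
      have h := ha _ (hmem x hx) _ (hmem y hy)
      rw [elim_sub_elim, norm_elim_zero] at h
      refine le_trans (le_of_eq_of_le ?_ (norm_comp_inl_le _)) h
      congr 1
      ext j
      have : (I₀ *ᵥ (Sum.elim (x - y) 0 : Param p₁ q)) (Sum.inl j) =
          (I₀.toBlocks₁₁ *ᵥ (x - y)) j := by
        simp [mulVec, dotProduct, toBlocks₁₁]
      simp [g, this]) hg0
  have hnear : Tendsto (fun a => C * ‖g a θ₁‖) l (𝓝 0) := by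
    simpa using hg0.norm.const_mul C
  obtain ⟨ε, hε, hball⟩ := Metric.nhds_basis_closedBall.mem_iff.1 hΘ
  refine ⟨C, hC, ?_⟩
  filter_upwards [hroot, ht, hnear.eventually_le_const hε] with a ⟨x, hx, hx0⟩ hta hsmall
  -- The root found near `θ₁` lies in `Θ`, so uniqueness identifies it with the estimate;
  -- consistency is thereby proved, not assumed.
  have hxt : x = t a := by
    refine (hta x).1 ⟨hball ?_, fun j => congrFun hx0 j⟩
    rw [Metric.mem_closedBall, dist_eq_norm, elim_sub_elim, norm_elim_zero]
    exact hx.trans hsmall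
  rw [← hxt]
  exact hx.trans (mul_le_mul_of_nonneg_left (norm_comp_inl_le _) hC)

/-- The limit of the scaled quadratic form in the profile score. -/
lemma tendsto_profile_quadForm (hI : I₀.PosDef)
    (hS : ∀ᶠ x in l ×ˢ 𝓝 (Sum.elim θ₁ θ₂ : Param p₁ q),
      HasFDerivAt (S x.1) (-mulVecCLM (J x.1 x.2)) x.2)
    (hJ : Tendsto (fun x : α × Param p₁ q => J x.1 x.2) (l ×ˢ 𝓝 (Sum.elim θ₁ θ₂)) (𝓝 I₀))
    (hΘ : Θ ∈ 𝓝 (Sum.elim θ₁ θ₂ : Param p₁ q)) (hm : Tendsto m l atTop)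
    (hr : Tendsto (fun a => m a • S a (Sum.elim θ₁ θ₂)) l (𝓝 r))
    (ht : ∀ᶠ a in l, ∀ s₁ : Fin p₁ → ℝ, (Sum.elim s₁ θ₂ ∈ Θ ∧
      ∀ j, S a (Sum.elim s₁ θ₂) (Sum.inl j) = 0) ↔ s₁ = t a) :
    Tendsto (fun a => m a ^ 2 * ((fun j => S a (Sum.elim (t a) θ₂) (Sum.inr j)) ⬝ᵥ
        ((schur221 (J a (Sum.elim (t a) θ₂)))⁻¹ *ᵥ
          fun j => S a (Sum.elim (t a) θ₂) (Sum.inr j)))) l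
      (𝓝 ((effRow I₀ *ᵥ r) ⬝ᵥ ((schur221 I₀)⁻¹ *ᵥ (effRow I₀ *ᵥ r)))) := by
  set θ₀ : Param p₁ q := Sum.elim θ₁ θ₂
  set θ : α → Param p₁ q := fun a => Sum.elim (t a) θ₂
  have happ (c : NNReal) (hc : 0 < c) := exists_approximatesLinearOn hS
    (f' := fun a x => -mulVecCLM (J a x)) (φ := -mulVecCLM I₀) (((continuous_mulVecCLM.tendsto I₀).comp hJ).neg) hc
  have hSlim : Tendsto (fun a => S a θ₀) l (𝓝 0) := by
    have h := hm.inv_tendsto_atTop.smul hr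
    rw [zero_smul] at h
    refine h.congr' ?_
    filter_upwards [hm.eventually_gt_atTop 0] with a ha
    simp [smul_smul, inv_mul_cancel₀ ha.ne']
  obtain ⟨C, hC, hbound⟩ := exists_profile_bound hI happ hΘ hSlim ht
  have hθnorm (a : α) : ‖θ a - θ₀‖ = ‖t a - θ₁‖ := by
    rw [elim_sub_elim, norm_elim_zero]
  have hθ : Tendsto θ l (𝓝 θ₀) := by
    rw [tendsto_iff_norm_sub_tendsto_zero]
    refine squeeze_zero' (Eventually.of_forall fun _ => norm_nonneg _)
      (hbound.mono fun a ha => (hθnorm a).trans_le ha) ?_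
    simpa using hSlim.norm.const_mul C
  -- The scaled linearization error. It vanishes because `m a * ‖t a - θ₁‖` stays below `C * (‖r‖ +
  -- 1)` while the slope error is arbitrarily small.
  set e : α → Param p₁ q := fun a => m a • (S a (θ a) - S a θ₀ + I₀ *ᵥ (θ a - θ₀))
  have he : Tendsto e l (𝓝 0) := by
    rw [NormedAddGroup.tendsto_nhds_zero]
    intro ε hε
    have hK : 0 < C * (‖r‖ + 1) + 1 := by positivity
    obtain ⟨δ, hδ, hδ'⟩ := happ (Real.toNNReal (ε / (C * (‖r‖ + 1) + 1) / 2)) (by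
      rw [Real.toNNReal_pos]; positivity)
    filter_upwards [hδ', hbound, hm.eventually_gt_atTop 0,
      hr.norm.eventually_lt_const (lt_add_one ‖r‖),
      hθ.eventually (Metric.closedBall_mem_nhds θ₀ hδ)] with a h1 h2 h3 h4 h5
    have h6 := h1 _ h5 _ (Metric.mem_closedBall_self hδ.le)
    rw [Real.coe_toNNReal _ (by positivity), hθnorm] at h6
    simp only [_root_.neg_apply, mulVecCLM_apply, sub_neg_eq_add] at h6
    have h7 : m a * ‖t a - θ₁‖ ≤ C * (‖r‖ + 1) := by
      calc m a * ‖t a - θ₁‖ ≤ m a * (C * ‖S a θ₀‖) := mul_le_mul_of_nonneg_left h2 h3.le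
        _ = C * ‖m a • S a θ₀‖ := by
          rw [norm_smul, Real.norm_of_nonneg h3.le]; ring
        _ ≤ _ := mul_le_mul_of_nonneg_left h4.le hC
    calc ‖e a‖ = m a * ‖S a (θ a) - S a θ₀ + I₀ *ᵥ (θ a - θ₀)‖ := by
          rw [norm_smul, Real.norm_of_nonneg h3.le]
      _ ≤ m a * (ε / (C * (‖r‖ + 1) + 1) / 2 * ‖t a - θ₁‖) :=
          mul_le_mul_of_nonneg_left h6 h3.le
      _ = ε / (C * (‖r‖ + 1) + 1) / 2 * (m a * ‖t a - θ₁‖) := by ring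
      _ ≤ ε / (C * (‖r‖ + 1) + 1) / 2 * (C * (‖r‖ + 1) + 1) :=
          mul_le_mul_of_nonneg_left (h7.trans (by linarith)) (by positivity)
      _ = ε / 2 := by field_simp
      _ < ε := half_lt_self hε
  have hS₂ : Tendsto (fun a => m a • fun j => S a (θ a) (Sum.inr j)) l (𝓝 (effRow I₀ *ᵥ r)) := by
    have hc : Continuous fun v : Param p₁ q => effRow I₀ *ᵥ v := by fun_prop
    have h := (hc.tendsto _).comp (hr.add he)
    rw [add_zero] at h
    refine h.congr' ?_
    filter_upwards [ht] with a hta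
    have hzero := ((hta (t a)).2 rfl).2
    -- Estimating the nuisance parameter has no first-order effect: `effRow I₀ * I₀` has zero first
    -- block and `θ a - θ₀` has zero second block.
    have h1 : effRow I₀ *ᵥ (I₀ *ᵥ (θ a - θ₀)) = 0 := by
      rw [mulVec_mulVec, effRow_mul (posDef_toBlocks₁₁ hI).isUnit, elim_sub_elim,
        fromCols_mulVec_sumElim]
      simp
    have h2 : effRow I₀ *ᵥ S a (θ a) = fun j => S a (θ a) (Sum.inr j) := by
      have : S a (θ a) = Sum.elim (0 : Fin p₁ → ℝ) fun j => S a (θ a) (Sum.inr j) := by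
        ext (j | j)
        · exact hzero j
        · rfl
      rw [this, effRow, fromCols_mulVec_sumElim]
      simp
    simp only [Function.comp_apply, e, ← smul_add, mulVec_smul]
    rw [show S a θ₀ + (S a (θ a) - S a θ₀ + I₀ *ᵥ (θ a - θ₀)) =
      S a (θ a) + I₀ *ᵥ (θ a - θ₀) by abel, mulVec_add, h1, h2, add_zero]
  have hJθ : Tendsto (fun a => J a (θ a)) l (𝓝 I₀) := hJ.comp (tendsto_id.prodMk hθ)
  have hschur : Tendsto (fun a => (schur221 (J a (θ a)))⁻¹) l (𝓝 (schur221 I₀)⁻¹) := by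
    refine tendsto_matrix_inv ?_ (posDef_schur221 hI).isUnit
    have hb {m n : Type} (f : m → Fin p₁ ⊕ Fin q) (g : n → Fin p₁ ⊕ Fin q) :
        Tendsto (fun a => (J a (θ a)).submatrix f g) l (𝓝 (I₀.submatrix f g)) :=
      ((continuous_id.matrix_submatrix f g).tendsto I₀).comp hJθ
    exact (hb Sum.inr Sum.inr).sub (tendsto_matrix_mul (tendsto_matrix_mul (hb Sum.inr Sum.inl)
      (tendsto_matrix_inv (hb Sum.inl Sum.inl) (posDef_toBlocks₁₁ hI).isUnit))
      (hb Sum.inl Sum.inr))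
  have hc : Continuous fun y : (Fin q → ℝ) × Matrix (Fin q) (Fin q) ℝ => y.1 ⬝ᵥ y.2 *ᵥ y.1 := by
    fun_prop
  refine ((hc.tendsto (effRow I₀ *ᵥ r, (schur221 I₀)⁻¹)).comp (hS₂.prodMk_nhds hschur)).congr
    fun a => ?_
  simp only [Function.comp_apply, mulVec_smul, smul_dotProduct, dotProduct_smul, smul_eq_mul]
  ring

end ProfileScore

/-! ### Derivatives of the quasi-score and the population information. -/

/-- The derivative is a pointwise limit of difference quotients with steps `1 / (n + 1)`; the index
is shifted by `n₀` so that all evaluation points lie where measurability is known. -/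
lemma measurable_fderiv_apply_of_eventually {𝒳 E : Type*} [MeasurableSpace 𝒳]
    [NormedAddCommGroup E] [NormedSpace ℝ E] {f : 𝒳 → E → ℝ} {θ : E}
    (hmeas : ∀ᶠ t in 𝓝 θ, Measurable fun x => f x t)
    (hdiff : ∀ x, DifferentiableAt ℝ (f x) θ) (v : E) :
    Measurable fun x => fderiv ℝ (f x) θ v := by
  have hlim : Tendsto (fun n : ℕ => θ + ((n : ℝ) + 1)⁻¹ • v) atTop (𝓝 θ) := by
    have h : Tendsto (fun n : ℕ => ((n : ℝ) + 1)⁻¹) atTop (𝓝 0) := by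
      simpa using tendsto_one_div_add_atTop_nhds_zero_nat (𝕜 := ℝ)
    simpa using (h.smul_const v).const_add θ
  obtain ⟨n₀, hn₀⟩ := eventually_atTop.1 (hlim.eventually hmeas)
  refine measurable_of_tendsto_metrizable
    (f := fun n x => ((n + n₀ : ℕ) + 1 : ℝ) • (f x (θ + (((n + n₀ : ℕ) : ℝ) + 1)⁻¹ • v) - f x θ))
    (fun n => ?_) ?_
  · have h1 := hn₀ (n + n₀) (Nat.le_add_left _ _)
    have h2 := hmeas.self_of_nhds
    fun_prop
  rw [tendsto_pi_nhds]
  intro x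
  have h := (hdiff x).hasFDerivAt.lim v (c := fun n : ℕ => (n : ℝ) + 1) (l := atTop) (by
    exact tendsto_norm_atTop_atTop.comp (tendsto_atTop_add_const_right _ _
      tendsto_natCast_atTop_atTop))
  exact h.comp (tendsto_add_atTop_nat n₀)

namespace QuasiModel

variable {𝒳 : Type*} {p₁ q : ℕ} {M : QuasiModel 𝒳 p₁ q} {Θ : Set (Param p₁ q)} {θ : Param p₁ q}

/-- The factor of the quasi-score which depends on the covariate only. -/
noncomputable def weight (M : QuasiModel 𝒳 p₁ q) (j : Fin p₁ ⊕ Fin q) (x : 𝒳) (θ : Param p₁ q) :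
    ℝ :=
  (M.workVar (M.mean x θ))⁻¹ * fderiv ℝ (M.mean x) θ (Pi.single j 1)

lemma contDiffAt_weight {x : 𝒳} (hmean : ContDiffAt ℝ 2 (M.mean x) θ)
    (hvar : ContDiffAt ℝ 1 M.workVar (M.mean x θ)) (hpos : 0 < M.workVar (M.mean x θ))
    (j : Fin p₁ ⊕ Fin q) : ContDiffAt ℝ 1 (M.weight j x) θ := by
  have h1 : ContDiffAt ℝ 1 (fun t => M.workVar (M.mean x t)) θ :=
    hvar.comp θ (hmean.of_le (by norm_num))
  have h2 : ContDiffAt ℝ 1 (fderiv ℝ (M.mean x)) θ := hmean.fderiv_right (by norm_num)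
  exact (h1.inv hpos.ne').mul (h2.clm_apply contDiffAt_const)

lemma score_eq (z : 𝒳 × ℝ) (t : Param p₁ q) (j : Fin p₁ ⊕ Fin q) :
    M.score t z j = (z.2 - M.mean z.1 t) * M.weight j z.1 t := by
  rw [score, weight, mul_assoc]

lemma contDiffAt_score {z : 𝒳 × ℝ} (hmean : ContDiffAt ℝ 2 (M.mean z.1) θ)
    (hvar : ContDiffAt ℝ 1 M.workVar (M.mean z.1 θ)) (hpos : 0 < M.workVar (M.mean z.1 θ))
    (j : Fin p₁ ⊕ Fin q) : ContDiffAt ℝ 1 (fun t => M.score t z j) θ := by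
  simp only [score_eq]
  exact (contDiffAt_const.sub (hmean.of_le (by norm_num))).mul
    (contDiffAt_weight hmean hvar hpos j)

lemma hasFDerivAt_score {z : 𝒳 × ℝ} (hmean : ContDiffAt ℝ 2 (M.mean z.1) θ)
    (hvar : ContDiffAt ℝ 1 M.workVar (M.mean z.1 θ)) (hpos : 0 < M.workVar (M.mean z.1 θ)) :
    HasFDerivAt (fun t => M.score t z) (-mulVecCLM (M.info θ z)) θ := by
  rw [hasFDerivAt_pi']
  intro j
  have h := ((contDiffAt_score hmean hvar hpos j).differentiableAt one_ne_zero).hasFDerivAt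
  convert h using 1
  ext v
  conv_rhs => rw [pi_eq_sum_univ' v]
  simp [info, Matrix.mulVec, dotProduct, mul_comm]

lemma continuousAt_info {z : 𝒳 × ℝ} (hmean : ContDiffAt ℝ 2 (M.mean z.1) θ)
    (hvar : ContDiffAt ℝ 1 M.workVar (M.mean z.1 θ)) (hpos : 0 < M.workVar (M.mean z.1 θ)) :
    ContinuousAt (fun t => M.info t z) θ := by
  refine tendsto_pi_nhds.2 fun j => tendsto_pi_nhds.2 fun k => ?_
  have h : ContDiffAt ℝ 0 (fderiv ℝ fun t => M.score t z j) θ :=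
    (contDiffAt_score hmean hvar hpos j).fderiv_right (by norm_num)
  exact (h.continuousAt.clm_apply continuousAt_const).neg

/-- The product rule separates a Gram term from a function of the covariate times the residual,
whose contribution to the expectation is to be removed. -/
lemma info_eq {z : 𝒳 × ℝ} (hmean : ContDiffAt ℝ 2 (M.mean z.1) θ)
    (hvar : ContDiffAt ℝ 1 M.workVar (M.mean z.1 θ)) (hpos : 0 < M.workVar (M.mean z.1 θ))
    (j k : Fin p₁ ⊕ Fin q) :
    M.info θ z j k = (M.workVar (M.mean z.1 θ))⁻¹ * (fderiv ℝ (M.mean z.1) θ (Pi.single j 1) *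
      fderiv ℝ (M.mean z.1) θ (Pi.single k 1)) -
      fderiv ℝ (M.weight j z.1) θ (Pi.single k 1) * (z.2 - M.mean z.1 θ) := by
  have h1 := (hmean.differentiableAt two_ne_zero).hasFDerivAt
  have h2 := ((contDiffAt_weight hmean hvar hpos j).differentiableAt one_ne_zero).hasFDerivAt
  have h3 := ((hasFDerivAt_const z.2 θ).sub h1).mul h2
  have h4 : (fun t => M.score t z j) = fun t => (z.2 - M.mean z.1 t) * M.weight j z.1 t :=
    funext fun t => score_eq z t j
  have h5 := h3.fderiv
  rw [show (((fun _ => z.2) - M.mean z.1) * M.weight j z.1) = fun t => M.score t z j from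
    h4.symm] at h5
  simp only [info, Matrix.of_apply, h5]
  simp [weight]
  ring

variable [MeasurableSpace 𝒳]

lemma measurable_weight_deriv (hmean_meas : ∀ θ ∈ Θ, Measurable fun x => M.mean x θ)
    (hvar_meas : Measurable M.workVar)
    (hmean_smooth : ∀ x, ∀ θ ∈ Θ, ContDiffAt ℝ 2 (M.mean x) θ)
    (hvar_smooth : ∀ x, ∀ θ ∈ Θ, ContDiffAt ℝ 1 M.workVar (M.mean x θ))
    (hvar_pos : ∀ x, ∀ θ ∈ Θ, 0 < M.workVar (M.mean x θ)) (hθ : Θ ∈ 𝓝 θ)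
    (j k : Fin p₁ ⊕ Fin q) :
    Measurable fun x => fderiv ℝ (M.weight j x) θ (Pi.single k 1) := by
  refine measurable_fderiv_apply_of_eventually ?_ (fun x => (contDiffAt_weight
    (hmean_smooth x θ (mem_of_mem_nhds hθ)) (hvar_smooth x θ (mem_of_mem_nhds hθ))
    (hvar_pos x θ (mem_of_mem_nhds hθ)) j).differentiableAt one_ne_zero) _
  filter_upwards [eventually_mem_nhds_iff.2 hθ] with t ht
  have h1 : Measurable fun x => fderiv ℝ (M.mean x) t (Pi.single j 1) :=
    measurable_fderiv_apply_of_eventually (Filter.mem_of_superset ht hmean_meas)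
      (fun x => (hmean_smooth x t (mem_of_mem_nhds ht)).differentiableAt two_ne_zero) _
  exact (hvar_meas.comp (hmean_meas t (mem_of_mem_nhds ht))).inv.mul h1

/-- Residuals are orthogonal to bounded functions of the covariate. -/
lemma setIntegral_mul_residual_eq_zero {ρ : Measure (𝒳 × ℝ)} [IsFiniteMeasure ρ] {μ g : 𝒳 → ℝ}
    (hY : Integrable (fun z : 𝒳 × ℝ => z.2) ρ)
    (hμ : ρ[fun z : 𝒳 × ℝ => z.2 | MeasurableSpace.comap Prod.fst inferInstance]
      =ᵐ[ρ] fun z => μ z.1)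
    (hg : Measurable g) {s : Set 𝒳} (hs : MeasurableSet s) {C : ℝ} (hC : ∀ x ∈ s, |g x| ≤ C) :
    IntegrableOn (fun z => g z.1 * (z.2 - μ z.1)) (Prod.fst ⁻¹' s) ρ ∧
      ∫ z in Prod.fst ⁻¹' s, g z.1 * (z.2 - μ z.1) ∂ρ = 0 := by
  set 𝓕 : MeasurableSpace (𝒳 × ℝ) := MeasurableSpace.comap Prod.fst inferInstance
  have h𝓕 : 𝓕 ≤ Prod.instMeasurableSpace := measurable_fst.comap_le
  set b : 𝒳 × ℝ → ℝ := fun z => s.indicator g z.1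
  have hb : Measurable[𝓕] b := (hg.indicator hs).comp (comap_measurable Prod.fst)
  have hbC (z : 𝒳 × ℝ) : ‖b z‖ ≤ |C| := by
    by_cases hz : z.1 ∈ s
    · simpa [b, hz] using (hC _ hz).trans (le_abs_self C)
    · simp [b, hz]
  have hμint : Integrable (fun z : 𝒳 × ℝ => μ z.1) ρ := integrable_condExp.congr hμ
  have hbm : AEStronglyMeasurable[Prod.instMeasurableSpace] b ρ := (hb.mono h𝓕 le_rfl).aestronglyMeasurable
  have h1 : Integrable (b * fun z => z.2) ρ := hY.bdd_mul hbm (ae_of_all _ hbC)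
  have h2 : Integrable (b * fun z => μ z.1) ρ := hμint.bdd_mul hbm (ae_of_all _ hbC)
  -- The bounded factor `b` depends on the covariate only, so it can be pulled out of the
  -- conditional expectation of `Y`.
  have h3 : ∫ z, (b * fun z : 𝒳 × ℝ => z.2) z ∂ρ =
      ∫ z, (b * fun z : 𝒳 × ℝ => μ z.1) z ∂ρ := by
    rw [← integral_condExp h𝓕]
    refine integral_congr_ae ((condExp_mul_of_stronglyMeasurable_left hb.stronglyMeasurable h1
      hY).trans ?_)
    filter_upwards [hμ] with z hz
    simp [hz]
  have h4 : (Prod.fst ⁻¹' s).indicator (fun z : 𝒳 × ℝ => g z.1 * (z.2 - μ z.1)) =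
      (b * fun z => z.2) - (b * fun z => μ z.1) := by
    ext z
    by_cases hz : z.1 ∈ s
    · simp [b, hz, mul_sub]
    · simp [b, hz]
  refine ⟨?_, ?_⟩
  · rw [← integrable_indicator_iff (measurable_fst hs), h4]
    exact h1.sub h2
  · rw [← integral_indicator (measurable_fst hs), h4]
    simp only [Pi.sub_apply]
    rw [integral_sub h1 h2, h3, sub_self]

/-- Under a correctly specified mean, the population information is symmetric and positive
semidefinite. -/
lemma posSemidef_popInfo {ρ : Measure (𝒳 × ℝ)} [IsFiniteMeasure ρ]
    (hmean_meas : ∀ θ ∈ Θ, Measurable fun x => M.mean x θ)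
    (hvar_meas : Measurable M.workVar)
    (hmean_smooth : ∀ x, ∀ θ ∈ Θ, ContDiffAt ℝ 2 (M.mean x) θ)
    (hvar_smooth : ∀ x, ∀ θ ∈ Θ, ContDiffAt ℝ 1 M.workVar (M.mean x θ))
    (hvar_pos : ∀ x, ∀ θ ∈ Θ, 0 < M.workVar (M.mean x θ)) (hΘ : Θ ∈ 𝓝 θ)
    (hY : Integrable (fun z : 𝒳 × ℝ => z.2) ρ)
    (hmodel : ρ[fun z : 𝒳 × ℝ => z.2 | MeasurableSpace.comap Prod.fst inferInstance]
      =ᵐ[ρ] fun z => M.mean z.1 θ)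
    (hint : ∀ j k, Integrable (fun z => M.info θ z j k) ρ) : (M.popInfo ρ θ).PosSemidef := by
  have hθ := mem_of_mem_nhds hΘ
  set g : Fin p₁ ⊕ Fin q → Fin p₁ ⊕ Fin q → 𝒳 → ℝ :=
    fun j k x => fderiv ℝ (M.weight j x) θ (Pi.single k 1)
  have hg (j k) : Measurable (g j k) := measurable_weight_deriv hmean_meas hvar_meas hmean_smooth
    hvar_smooth hvar_pos hΘ j k
  set d : Fin p₁ ⊕ Fin q → 𝒳 × ℝ → ℝ := fun j z => fderiv ℝ (M.mean z.1) θ (Pi.single j 1)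
  set a : Fin p₁ ⊕ Fin q → Fin p₁ ⊕ Fin q → 𝒳 × ℝ → ℝ :=
    fun j k z => (M.workVar (M.mean z.1 θ))⁻¹ * (d j z * d k z) with ha
  -- Only the sum of the Gram and residual terms is known to be integrable. On `s n` the weight
  -- derivatives are bounded, so the residual term is integrable with integral zero; then `n → ∞`.
  set s : ℕ → Set 𝒳 := fun n => ⋂ j, ⋂ k, {x | |g j k x| ≤ n}
  have hs (n : ℕ) : MeasurableSet (s n) := MeasurableSet.iInter fun j => MeasurableSet.iInter
    fun k => measurableSet_le (hg j k).abs measurable_const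
  have hmem (n : ℕ) (x : 𝒳) : x ∈ s n ↔ ∀ j k, |g j k x| ≤ n := by
    simp only [s, Set.mem_iInter]
    rfl
  have hmono : Monotone fun n => (Prod.fst ⁻¹' s n : Set (𝒳 × ℝ)) := by
    intro n n' hn z hz
    have hz : z.1 ∈ s n := hz
    change z.1 ∈ s n'
    rw [hmem] at hz ⊢
    exact fun j k => (hz j k).trans (by exact_mod_cast hn)
  have hunion : ⋃ n, (Prod.fst ⁻¹' s n : Set (𝒳 × ℝ)) = Set.univ := by
    refine Set.eq_univ_of_forall fun z => ?_
    obtain ⟨n, hn⟩ := exists_nat_ge (∑ j, ∑ k, |g j k z.1|)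
    refine Set.mem_iUnion.2 ⟨n, (hmem n z.1).2 fun j k => ?_⟩
    exact ((Finset.single_le_sum (f := fun k => |g j k z.1|) (fun k _ => abs_nonneg _)
      (Finset.mem_univ k)).trans (Finset.single_le_sum (f := fun j => ∑ k, |g j k z.1|)
      (fun j _ => Finset.sum_nonneg fun k _ => abs_nonneg _) (Finset.mem_univ j))).trans hn
  have hinfo (j k) (z : 𝒳 × ℝ) : M.info θ z j k = a j k z - g j k z.1 * (z.2 - M.mean z.1 θ) :=
    info_eq (hmean_smooth _ θ hθ) (hvar_smooth _ θ hθ) (hvar_pos _ θ hθ) j k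
  have hres (j k) (n : ℕ) := setIntegral_mul_residual_eq_zero
    (μ := fun x => M.mean x θ) hY hmodel (hg j k) (hs n)
    (C := n) fun x hx => (hmem n x).1 hx j k
  have haint (j k) (n : ℕ) : IntegrableOn (a j k) (Prod.fst ⁻¹' s n) ρ := by
    have h := (hint j k).integrableOn.add (hres j k n).1
    refine h.congr (ae_of_all _ fun z => ?_)
    simp [hinfo]
  have haeq (j k) (n : ℕ) : ∫ z in Prod.fst ⁻¹' s n, M.info θ z j k ∂ρ =
      ∫ z in Prod.fst ⁻¹' s n, a j k z ∂ρ := by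
    simp only [hinfo]
    rw [integral_sub (haint j k n) (hres j k n).1, (hres j k n).2, sub_zero]
  have hlim (j k) : Tendsto (fun n => ∫ z in Prod.fst ⁻¹' s n, a j k z ∂ρ) atTop
      (𝓝 (M.popInfo ρ θ j k)) := by
    have h := tendsto_setIntegral_of_monotone (μ := ρ) (f := fun z => M.info θ z j k)
      (fun n => measurable_fst (hs n)) hmono (hint j k).integrableOn
    rw [hunion, Measure.restrict_univ] at h
    exact h.congr fun n => haeq j k n
  refine Matrix.PosSemidef.of_dotProduct_mulVec_nonneg ?_ fun v => ?_
  · ext j k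
    refine tendsto_nhds_unique ((hlim k j).congr fun n => ?_) (hlim j k)
    simp only [ha, mul_comm (d k _)]
  · have h : Tendsto (fun n => ∑ j, ∑ k, v j * v k * ∫ z in Prod.fst ⁻¹' s n, a j k z ∂ρ) atTop
        (𝓝 (∑ j, ∑ k, v j * v k * M.popInfo ρ θ j k)) :=
      tendsto_finsetSum _ fun j _ => tendsto_finsetSum _ fun k _ => (hlim j k).const_mul _
    have heq : star v ⬝ᵥ (M.popInfo ρ θ).mulVec v = ∑ j, ∑ k, v j * v k * M.popInfo ρ θ j k := by
      simp only [dotProduct, Matrix.mulVec, Pi.star_apply, star_trivial, Finset.mul_sum]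
      exact Finset.sum_congr rfl fun j _ => Finset.sum_congr rfl fun k _ => by ring
    rw [heq]
    refine ge_of_tendsto' h fun n => ?_
    have hterm (j k) : v j * v k * ∫ z in Prod.fst ⁻¹' s n, a j k z ∂ρ =
        ∫ z in Prod.fst ⁻¹' s n, v j * v k * a j k z ∂ρ := (integral_const_mul _ _).symm
    simp only [hterm]
    have hsum (j) : ∑ k, ∫ z in Prod.fst ⁻¹' s n, v j * v k * a j k z ∂ρ =
        ∫ z in Prod.fst ⁻¹' s n, ∑ k, v j * v k * a j k z ∂ρ :=
      (integral_finsetSum _ fun k _ => (haint j k n).const_mul _).symm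
    simp only [hsum]
    rw [← integral_finsetSum _ fun j _ => integrable_finsetSum _ fun k _ =>
      (haint j k n).const_mul _]
    refine integral_nonneg fun z => ?_
    have : ∑ j, ∑ k, v j * v k * a j k z =
        (M.workVar (M.mean z.1 θ))⁻¹ * ((∑ j, v j * d j z) * ∑ k, v k * d k z) := by
      rw [Finset.sum_mul_sum]
      simp only [Finset.mul_sum, ha]
      exact Finset.sum_congr rfl fun j _ => Finset.sum_congr rfl fun k _ => by ring
    simp only [this]
    exact mul_nonneg (inv_nonneg.2 (hvar_pos _ θ hθ).le) (mul_self_nonneg _)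

end QuasiModel

/-! ### Stochastic limits of the score, the information and the statistic. -/

section Assembly

open Matrix

variable {Ω 𝒳 : Type*} [MeasurableSpace Ω] [MeasurableSpace 𝒳] {P : Measure Ω}
  {ρ : Measure (𝒳 × ℝ)} {p₁ q : ℕ}

instance highProb_neBot [IsProbabilityMeasure P] : (highProb P).NeBot := by
  refine ⟨fun h => ?_⟩
  have h1 : ∀ᶠ a in highProb P, False := by simp [h]
  rw [eventually_highProb] at h1
  have h2 : {ω : Ω | ¬ False} = Set.univ := by simp
  rw [h2, measure_univ] at h1
  exact one_ne_zero (tendsto_nhds_unique tendsto_const_nhds h1)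

namespace SurveySequence

variable {D : SurveySequence P ρ} {M : QuasiModel 𝒳 p₁ q} {θ : Param p₁ q}

lemma hasFDerivAt_wScore (hmean : ∀ x, ContDiffAt ℝ 2 (M.mean x) θ)
    (hvar : ∀ x, ContDiffAt ℝ 1 M.workVar (M.mean x θ)) (hpos : ∀ x, 0 < M.workVar (M.mean x θ))
    (ν : ℕ) (ω : Ω) : HasFDerivAt (D.wScore M ν ω) (-mulVecCLM (D.wInfo M ν ω θ)) θ := by
  have h := (HasFDerivAt.fun_sum (u := D.sample ν ω) fun i _ =>
    (QuasiModel.hasFDerivAt_score (z := D.unit ν i ω) (hmean _) (hvar _) (hpos _)).const_smul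
      (D.inclProb ν i ω)⁻¹).const_smul (D.popSize ν : ℝ)⁻¹
  have h' : -mulVecCLM (D.wInfo M ν ω θ) = (D.popSize ν : ℝ)⁻¹ • ∑ i ∈ D.sample ν ω,
      (D.inclProb ν i ω)⁻¹ • -mulVecCLM (M.info θ (D.unit ν i ω)) := by
    simp [wInfo]
  rw [h']
  exact h

lemma continuousAt_wInfo (hmean : ∀ x, ContDiffAt ℝ 2 (M.mean x) θ)
    (hvar : ∀ x, ContDiffAt ℝ 1 M.workVar (M.mean x θ)) (hpos : ∀ x, 0 < M.workVar (M.mean x θ))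
    (ν : ℕ) (ω : Ω) : ContinuousAt (D.wInfo M ν ω) θ :=
  (tendsto_finsetSum _ fun i _ => (QuasiModel.continuousAt_info (z := D.unit ν i ω) (hmean _)
    (hvar _) (hpos _)).const_smul (D.inclProb ν i ω)⁻¹).const_smul (D.popSize ν : ℝ)⁻¹

/-- Uniform convergence in probability of the weighted information, which is continuous, gives
joint convergence as the parameter tends to the true value. -/
lemma tendsto_wInfo [IsProbabilityMeasure P] {B : Set (Param p₁ q)} (hB : B ∈ 𝓝 θ)
    (hcont : ∀ ν ω, ContinuousAt (D.wInfo M ν ω) θ)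
    (hinfo : ∀ ε : ℝ, 0 < ε → Tendsto
      (fun ν => P {ω | ∃ θ ∈ B, ∃ j k, ε ≤ |D.wInfo M ν ω θ j k - M.popInfo ρ θ j k|})
      atTop (𝓝 0)) :
    Tendsto (fun x : (ℕ × Ω) × Param p₁ q => D.wInfo M x.1.1 x.1.2 x.2) (highProb P ×ˢ 𝓝 θ)
      (𝓝 (M.popInfo ρ θ)) := by
  have hunif (ε : ℝ) (hε : 0 < ε) : ∀ᶠ a in highProb P, ∀ t ∈ B, ∀ j k,
      |D.wInfo M a.1 a.2 t j k - M.popInfo ρ t j k| < ε := by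
    rw [eventually_highProb]
    refine (hinfo ε hε).congr fun n => congrArg P ?_
    ext ω
    change _ ↔ ¬ _
    push Not
    rfl
  refine tendsto_pi_nhds.2 fun j => tendsto_pi_nhds.2 fun k => ?_
  rw [Metric.tendsto_nhds]
  intro ε hε
  have hev := hunif (ε / 4) (by positivity)
  -- Continuity of `popInfo` is not given. One fixed realization `a₀`, which is uniformly close to
  -- it on `B` and continuous at `θ`, replaces it in a comparison with four errors `ε / 4`.
  obtain ⟨a₀, ha₀⟩ := hev.exists
  have hc : Tendsto (fun t => D.wInfo M a₀.1 a₀.2 t j k) (𝓝 θ)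
      (𝓝 (D.wInfo M a₀.1 a₀.2 θ j k)) :=
    tendsto_pi_nhds.1 (tendsto_pi_nhds.1 (hcont a₀.1 a₀.2) j) k
  have hnear := (Metric.tendsto_nhds.1 hc (ε / 4) (by positivity)).and hB
  filter_upwards [hev.prod_mk hnear] with x hx
  obtain ⟨h1, h2, h3⟩ := hx
  have h4 := h1 x.2 h3 j k
  have h5 := ha₀ x.2 h3 j k
  have h6 := ha₀ θ (mem_of_mem_nhds hB) j k
  rw [Real.dist_eq] at h2 ⊢
  rw [abs_lt] at *
  constructor <;> linarith

end SurveySequence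

/-- The law of a definite quadratic form in a normal vector as a weighted sum of chi-squares. -/
lemma exists_weighted_chiSq {I V H : Matrix (Fin p₁ ⊕ Fin q) (Fin p₁ ⊕ Fin q) ℝ} (hI : I.PosDef)
    (hV : V.PosDef) (hH : H * Hᵀ = V) :
    ∃ c : Fin q → ℝ, Antitone c ∧ (∀ i, 0 < c i) ∧
      ((asymVar I V).toBlocks₂₂ * schur221 I).charpoly
        = ∏ i, (Polynomial.X - Polynomial.C (c i)) ∧
      (stdNormal (Fin p₁ ⊕ Fin q)).map (fun z => (effRow I *ᵥ (H *ᵥ z)) ⬝ᵥ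
        ((schur221 I)⁻¹ *ᵥ (effRow I *ᵥ (H *ᵥ z)))) =
      (stdNormal (Fin q)).map fun z => ∑ i, c i * z i ^ 2 := by
  have hK := (posDef_schur221 hI).inv
  have hSdet : IsUnit (schur221 I).det := (isUnit_iff_isUnit_det _).1 (posDef_schur221 hI).isUnit
  have hSsym : (schur221 I)ᵀ = schur221 I := by
    simpa [IsHermitian] using (posDef_schur221 hI).isHermitian
  obtain ⟨R, hRsym, hRR⟩ := exists_psd_sq hK
  have hRunit : IsUnit R := by
    rw [isUnit_iff_isUnit_det]
    have : IsUnit (R * R).det := by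
      rw [hRR]
      exact (isUnit_iff_isUnit_det _).1 hK.isUnit
    rw [det_mul] at this
    exact isUnit_of_mul_isUnit_left this
  set G : Matrix (Fin q) (Fin p₁ ⊕ Fin q) ℝ := R * effRow I * H with hG
  have hGG : G * Gᵀ = R * effRow I * V * (R * effRow I)ᵀ := by
    rw [hG, transpose_mul, ← hH]
    simp only [Matrix.mul_assoc]
  have hpd : (G * Gᵀ).PosDef := by
    rw [hGG]
    have hinj : Function.Injective (R * effRow I).vecMul := by
      intro v w h
      simp only [← vecMul_vecMul] at h
      exact vecMul_injective_of_isUnit hRunit (effRow_vecMul_injective h)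
    simpa using hV.mul_mul_conjTranspose_same hinj
  obtain ⟨c, U, hanti, hcpos, hU, hspec, hchar⟩ := exists_sorted_spectral hpd
  refine ⟨c, hanti, hcpos, ?_, ?_⟩
  · rw [← hchar, asymVar_toBlocks₂₂ hI, hGG]
    -- With one factor `R` of `(schur221 I)⁻¹` in front, moving it to the end gives the symmetric
    -- matrix `G * Gᵀ` and keeps the characteristic polynomial.
    have h1 : (schur221 I)⁻¹ * effRow I * V * ((schur221 I)⁻¹ * effRow I)ᵀ * schur221 I =
        R * (R * effRow I * V * (effRow I)ᵀ) := by
      rw [transpose_mul, transpose_nonsing_inv, hSsym]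
      simp only [Matrix.mul_assoc]
      rw [nonsing_inv_mul _ hSdet, Matrix.mul_one, ← hRR]
      simp only [Matrix.mul_assoc]
    rw [h1, charpoly_mul_comm, transpose_mul, hRsym]
    simp only [Matrix.mul_assoc]
  -- `B` is a square factor of the same covariance, so `G *ᵥ z` may be replaced by `B *ᵥ z` in law;
  -- orthogonality of `U` turns its squared length into `∑ i, c i * z i ^ 2`.
  · set B : Matrix (Fin q) (Fin q) ℝ := U * diagonal fun i => √(c i) with hB
    have hBB : G * Gᵀ = B * Bᵀ := by
      have : diagonal c = (diagonal fun i => √(c i)) * diagonal fun i => √(c i) := by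
        rw [diagonal_mul_diagonal]
        congr 1
        ext i
        rw [Real.mul_self_sqrt (hcpos i).le]
      rw [hspec, this, hB, transpose_mul, diagonal_transpose]
      simp only [Matrix.mul_assoc]
    have hlaw := map_mulVec_stdNormal_eq hBB
    have hsq : Measurable fun y : Fin q → ℝ => y ⬝ᵥ y :=
      (by fun_prop : Continuous fun y : Fin q → ℝ => y ⬝ᵥ y).measurable
    have hGm : Measurable G.mulVec :=
      (by fun_prop : Continuous fun z : Fin p₁ ⊕ Fin q → ℝ => G *ᵥ z).measurable
    have hBm : Measurable B.mulVec :=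
      (by fun_prop : Continuous fun z : Fin q → ℝ => B *ᵥ z).measurable
    have h1 : (fun z => (effRow I *ᵥ (H *ᵥ z)) ⬝ᵥ
        ((schur221 I)⁻¹ *ᵥ (effRow I *ᵥ (H *ᵥ z)))) =
        (fun y : Fin q → ℝ => y ⬝ᵥ y) ∘ G.mulVec := by
      ext z
      have hGz : G *ᵥ z = R *ᵥ (effRow I *ᵥ (H *ᵥ z)) := by
        simp only [hG, mulVec_mulVec, Matrix.mul_assoc]
      rw [Function.comp_apply, hGz, ← hRR, ← mulVec_mulVec, dotProduct_mulVec,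
        ← mulVec_transpose, hRsym]
    have h2 : (fun z : Fin q → ℝ => ∑ i, c i * z i ^ 2) =
        (fun y : Fin q → ℝ => y ⬝ᵥ y) ∘ B.mulVec := by
      ext z
      have hBz : B *ᵥ z = U *ᵥ fun i => √(c i) * z i := by
        rw [hB, ← mulVec_mulVec]
        congr 1
        ext i
        rw [mulVec_diagonal]
      rw [Function.comp_apply, hBz, dotProduct_mulVec, ← mulVec_transpose, mulVec_mulVec, hU,
        one_mulVec]
      refine Finset.sum_congr rfl fun i _ => ?_
      linear_combination (- z i ^ 2) * (Real.mul_self_sqrt (hcpos i).le)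
    rw [h1, h2, ← Measure.map_map hsq hGm, ← Measure.map_map hsq hBm, hlaw]

/-- The scaled score, which is standardized in the central limit theorem, converges in
distribution. -/
lemma exists_tendstoInDistribution_unstudentized [IsProbabilityMeasure P] {ι : Type*} [Fintype ι]
    [DecidableEq ι] {V : ℕ → Matrix ι ι ℝ} {s : ℕ → ℝ} {W : Matrix ι ι ℝ} {X : ℕ → Ω → ι → ℝ}
    (hs : Tendsto s atTop atTop) (hV : Tendsto (fun n => s n • V n) atTop (𝓝 W)) (hW : W.PosDef)
    (hsym : ∀ n, (V n)ᵀ = V n)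
    (hclt : TendstoInDistribution (fun n ω => invSqrt (V n) *ᵥ X n ω) atTop
      (fun z : ι → ℝ => z) (fun _ => P) (stdNormal ι)) :
    ∃ (H : Matrix ι ι ℝ) (R : ℕ → Ω → ι → ℝ), H * Hᵀ = W ∧
      (∀ᶠ n in atTop, ∀ ω, R n ω = √(s n) • X n ω) ∧
      TendstoInDistribution R atTop (fun z => H *ᵥ z) (fun _ => P) (stdNormal ι) := by
  obtain ⟨H, A, hH, hA, hev⟩ := exists_tendsto_mul_invSqrt hs hV hW hsym
  refine ⟨H, fun n ω => A n *ᵥ (invSqrt (V n) *ᵥ X n ω), hH, ?_, ?_⟩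
  · filter_upwards [hev] with n hn ω
    rw [mulVec_mulVec, hn, smul_mulVec, one_mulVec]
  -- Slutsky's theorem, with the deterministic `A n` regarded as constant random variables.
  · let A' : ℕ → ι → ι → ℝ := A
    let H' : ι → ι → ℝ := H
    have hlim : Tendsto A' atTop (𝓝 H') := hA
    have hA' : TendstoInMeasure P (fun n (_ : Ω) => A' n) atTop fun _ => H' := by
      rw [tendstoInMeasure_iff_dist]
      intro ε hε
      refine tendsto_const_nhds.congr' ?_
      filter_upwards [Metric.tendsto_nhds.1 hlim ε hε] with n hn
      simp [not_le.2 hn]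
    have hc : Continuous fun y : (ι → ℝ) × (ι → ι → ℝ) => (Matrix.of y.2) *ᵥ y.1 :=
      Continuous.matrix_mulVec (A := fun y : (ι → ℝ) × (ι → ι → ℝ) => Matrix.of y.2)
        continuous_snd continuous_fst
    exact hclt.continuous_comp_prodMk_of_tendstoInMeasure_const hc hA'
      fun _ => aemeasurable_const

lemma varScore_transpose {D : SurveySequence P ρ} {M : QuasiModel 𝒳 p₁ q} {θ : Param p₁ q}
    (ν : ℕ) : (D.varScore M ν θ)ᵀ = D.varScore M ν θ := by
  ext j k
  exact covariance_comm _ _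

/-- The statistic differs from a quadratic form in the scaled score at the true value by a term
which vanishes in probability. -/
lemma tendstoInMeasure_quasiScoreStat_sub [IsProbabilityMeasure P] {M : QuasiModel 𝒳 p₁ q}
    {Θ : Set (Param p₁ q)} {θ₁ : Fin p₁ → ℝ} {θ₂ : Fin q → ℝ} {D : SurveySequence P ρ}
    {I : Matrix (Fin p₁ ⊕ Fin q) (Fin p₁ ⊕ Fin q) ℝ} {R : ℕ → Ω → Param p₁ q}
    {Z : Param p₁ q → Param p₁ q} {μ : Measure (Param p₁ q)} [IsProbabilityMeasure μ]
    {t : ℕ → Ω → Fin p₁ → ℝ} (hI : I.PosDef) (hΘ : Θ ∈ 𝓝 (Sum.elim θ₁ θ₂ : Param p₁ q))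
    (hderiv : ∀ ν ω, ∀ θ ∈ Θ, HasFDerivAt (D.wScore M ν ω) (-mulVecCLM (D.wInfo M ν ω θ)) θ)
    (hJ : Tendsto (fun x : (ℕ × Ω) × Param p₁ q => D.wInfo M x.1.1 x.1.2 x.2)
      (highProb P ×ˢ 𝓝 (Sum.elim θ₁ θ₂)) (𝓝 I))
    (hn : Tendsto D.expSize atTop atTop)
    (hsize : TendstoInMeasure P (fun ν ω => D.size ν ω / D.expSize ν) atTop (fun _ => 1))
    (hR : ∀ᶠ ν in atTop, ∀ ω, R ν ω = √(D.expSize ν) • D.wScore M ν ω (Sum.elim θ₁ θ₂))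
    (hRlim : TendstoInDistribution R atTop Z (fun _ => P) μ)
    (hsol : Tendsto (fun ν => P {ω | ¬ D.IsProfileSolution M Θ ν ω θ₂ (t ν ω)}) atTop (𝓝 0)) :
    TendstoInMeasure P (fun ν ω => D.size ν ω * D.quasiScoreStat M ν ω θ₂ (t ν ω) -
      (effRow I *ᵥ R ν ω) ⬝ᵥ ((schur221 I)⁻¹ *ᵥ (effRow I *ᵥ R ν ω))) atTop 0 := by
  refine tendstoInMeasure_of_tendsto_highProb (Metric.tendsto_nhds.2 fun ε hε => ?_)
  -- Once `R` is bounded by `K`, it has a limit `r` along every ultrafilter, and the deterministic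
  -- expansion gives the same limit for both terms of the difference.
  refine eventually_highProb_of_tight hRlim fun K => ?_
  suffices h : Tendsto (fun a : ℕ × Ω =>
      D.size a.1 a.2 * D.quasiScoreStat M a.1 a.2 θ₂ (t a.1 a.2) -
        (effRow I *ᵥ R a.1 a.2) ⬝ᵥ ((schur221 I)⁻¹ *ᵥ (effRow I *ᵥ R a.1 a.2)))
      (highProb P ⊓ 𝓟 {a | ‖R a.1 a.2‖ ≤ K}) (𝓝 0) from
    eventually_inf_principal.1 (Metric.tendsto_nhds.1 h ε hε)
  rw [tendsto_iff_ultrafilter]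
  intro u hu
  have hu1 : (u : Filter (ℕ × Ω)) ≤ highProb P := hu.trans inf_le_left
  have hu2 : ∀ᶠ a in (u : Filter (ℕ × Ω)), ‖R a.1 a.2‖ ≤ K :=
    hu (mem_inf_of_right (mem_principal_self _))
  have hfst : Tendsto Prod.fst (u : Filter (ℕ × Ω)) atTop := tendsto_fst_highProb.mono_left hu1
  obtain ⟨r, -, hr⟩ := (isCompact_closedBall (0 : Param p₁ q) K).ultrafilter_le_nhds
    (u.map fun a => R a.1 a.2) (le_principal_iff.2 (mem_map.2 (hu2.mono fun a ha => by
      simpa using ha)))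
  have hr : Tendsto (fun a : ℕ × Ω => R a.1 a.2) u (𝓝 r) := hr
  have hr' : Tendsto (fun a : ℕ × Ω => √(D.expSize a.1) • D.wScore M a.1 a.2 (Sum.elim θ₁ θ₂)) u
      (𝓝 r) := hr.congr' ((hfst.eventually hR).mono fun a ha => ha a.2)
  have hstat := tendsto_profile_quadForm (l := (u : Filter (ℕ × Ω)))
    (S := fun a => D.wScore M a.1 a.2) (J := fun a => D.wInfo M a.1 a.2)
    (m := fun a => √(D.expSize a.1)) (t := fun a => t a.1 a.2) hI
    ((eventually_of_mem hΘ fun θ hθ => hθ).prod_inr _ |>.mono fun x hx => hderiv _ _ _ hx)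
    (hJ.mono_left (prod_mono hu1 le_rfl)) hΘ
    ((Real.tendsto_sqrt_atTop.comp hn).comp hfst) hr' (hu1 (eventually_highProb.2 hsol))
  have hratio := (tendsto_highProb_of_tendstoInMeasure hsize).mono_left hu1
  have hc : Continuous fun v : Param p₁ q =>
      (effRow I *ᵥ v) ⬝ᵥ ((schur221 I)⁻¹ *ᵥ (effRow I *ᵥ v)) := by fun_prop
  have hlim := (hratio.mul hstat).sub ((hc.tendsto r).comp hr)
  rw [one_mul, sub_self] at hlim
  refine hlim.congr' ?_
  filter_upwards [(hn.comp hfst).eventually_gt_atTop 0] with a ha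
  have ha : 0 < D.expSize a.1 := ha
  rw [Real.sq_sqrt ha.le, ← mul_assoc, div_mul_cancel₀ _ ha.ne']
  rfl

end Assembly

theorem theorem4 {Ω 𝒳 : Type*} [MeasurableSpace Ω] [MeasurableSpace 𝒳]
    (P : Measure Ω) [IsProbabilityMeasure P]
    (ρ : Measure (𝒳 × ℝ)) [IsProbabilityMeasure ρ] {p₁ q : ℕ}
    -- the model
    (M : QuasiModel 𝒳 p₁ q) (Θ B : Set (Param p₁ q)) (θ₀ : Param p₁ q)
    (hBΘ : B ⊆ Θ) (hB : B ∈ 𝓝 θ₀)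
    (hmean_meas : ∀ θ ∈ Θ, Measurable fun x => M.mean x θ)
    (hvar_meas : Measurable M.workVar)
    (hmean_smooth : ∀ x, ∀ θ ∈ Θ, ContDiffAt ℝ 2 (M.mean x) θ)
    (hvar_smooth : ∀ x, ∀ θ ∈ Θ, ContDiffAt ℝ 1 M.workVar (M.mean x θ))
    (hvar_pos : ∀ x, ∀ θ ∈ Θ, 0 < M.workVar (M.mean x θ))
    (hY : Integrable (fun z : 𝒳 × ℝ => z.2) ρ)
    (hmodel : ρ[fun z : 𝒳 × ℝ => z.2 | MeasurableSpace.comap Prod.fst inferInstance]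
      =ᵐ[ρ] fun z => M.mean z.1 θ₀)
    -- the null hypothesis
    (θ₂null : Fin q → ℝ) (hH₀ : ∀ j, θ₀ (Sum.inr j) = θ₂null j)
    -- the populations and the samples, with `n → ∞`
    (D : SurveySequence P ρ)
    (hn : Tendsto D.expSize atTop atTop)
    (hsize : TendstoInMeasure P (fun ν ω => D.size ν ω / D.expSize ν) atTop (fun _ => 1))
    -- convergence of the variance of the weighted score
    (VS : Matrix (Fin p₁ ⊕ Fin q) (Fin p₁ ⊕ Fin q) ℝ) (hVS : VS.PosDef)
    (hvar : Tendsto (fun ν => D.expSize ν • D.varScore M ν θ₀) atTop (𝓝 VS))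
    -- convergence of the weighted information
    (hinfo_int : ∀ θ ∈ B, ∀ j k, Integrable (fun z => M.info θ z j k) ρ)
    (hinfo : ∀ ε : ℝ, 0 < ε → Tendsto
      (fun ν => P {ω | ∃ θ ∈ B, ∃ j k, ε ≤ |D.wInfo M ν ω θ j k - M.popInfo ρ θ j k|})
      atTop (𝓝 0))
    (hinv : IsUnit (M.popInfo ρ θ₀))
    -- central limit theorem for the weighted score
    (hclt : TendstoInDistribution
      (fun ν ω => (invSqrt (D.varScore M ν θ₀)).mulVec (D.wScore M ν ω θ₀)) atTop
      (fun z : Fin p₁ ⊕ Fin q → ℝ => z) (fun _ => P) (stdNormal (Fin p₁ ⊕ Fin q)))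
    -- the profile estimator
    (θhat₁ : ℕ → Ω → Fin p₁ → ℝ)
    (hsol : Tendsto
      (fun ν => P {ω | ¬ D.IsProfileSolution M Θ ν ω θ₂null (θhat₁ ν ω)}) atTop (𝓝 0))
    (hstat_meas : ∀ ν,
      AEMeasurable (fun ω => D.size ν ω * D.quasiScoreStat M ν ω θ₂null (θhat₁ ν ω)) P) :
    ∃ c : Fin q → ℝ, Antitone c ∧ (∀ i, 0 < c i) ∧
      ((asymVar (M.popInfo ρ θ₀) VS).toBlocks₂₂ * schur221 (M.popInfo ρ θ₀)).charpoly
        = ∏ i, (Polynomial.X - Polynomial.C (c i)) ∧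
      TendstoInDistribution
        (fun ν ω => D.size ν ω * D.quasiScoreStat M ν ω θ₂null (θhat₁ ν ω)) atTop
        (fun z : Fin q → ℝ => ∑ i, c i * z i ^ 2) (fun _ => P) (stdNormal (Fin q)) := by
  obtain ⟨θ₁, rfl⟩ : ∃ θ₁ : Fin p₁ → ℝ, θ₀ = Sum.elim θ₁ θ₂null :=
    ⟨fun j => θ₀ (Sum.inl j), by ext (j | j) <;> simp [hH₀]⟩
  have hΘ : Θ ∈ 𝓝 (Sum.elim θ₁ θ₂null : Param p₁ q) := mem_of_superset hB hBΘ
  have hθ₀ := mem_of_mem_nhds hΘ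
  have hI : (M.popInfo ρ (Sum.elim θ₁ θ₂null)).PosDef :=
    (QuasiModel.posSemidef_popInfo hmean_meas hvar_meas hmean_smooth hvar_smooth hvar_pos hΘ hY
      hmodel (hinfo_int _ (mem_of_mem_nhds hB))).posDef_iff_isUnit.2 hinv
  obtain ⟨H, R, hH, hR, hRlim⟩ := exists_tendstoInDistribution_unstudentized hn hvar hVS
    (fun ν => varScore_transpose ν) hclt
  obtain ⟨c, hanti, hpos, hchar, hlaw⟩ := exists_weighted_chiSq hI hVS hH
  refine ⟨c, hanti, hpos, hchar, ?_⟩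
  have hsub := tendstoInMeasure_quasiScoreStat_sub hI hΘ
    (fun ν ω θ hθ => SurveySequence.hasFDerivAt_wScore (fun x => hmean_smooth x θ hθ)
      (fun x => hvar_smooth x θ hθ) (fun x => hvar_pos x θ hθ) ν ω)
    (SurveySequence.tendsto_wInfo hB
      (SurveySequence.continuousAt_wInfo (fun x => hmean_smooth x _ hθ₀)
        (fun x => hvar_smooth x _ hθ₀) fun x => hvar_pos x _ hθ₀) hinfo)
    hn hsize hR hRlim hsol
  set Q : Param p₁ q → ℝ := fun v => (effRow (M.popInfo ρ (Sum.elim θ₁ θ₂null))).mulVec v ⬝ᵥ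
    ((schur221 (M.popInfo ρ (Sum.elim θ₁ θ₂null)))⁻¹).mulVec
      ((effRow (M.popInfo ρ (Sum.elim θ₁ θ₂null))).mulVec v) with hQ
  have hQc : Continuous Q := by fun_prop
  -- The continuous image `Q` of the scaled score converges in distribution, and a difference
  -- vanishing in probability does not change the limit.
  have hlim := tendstoInDistribution_of_tendstoInMeasure_sub _ _ (hRlim.continuous_comp hQc)
    hsub hstat_meas
  have hchi : AEMeasurable (fun z : Fin q → ℝ => ∑ i, c i * z i ^ 2) (stdNormal (Fin q)) :=
    (by fun_prop : Continuous fun z : Fin q → ℝ => ∑ i, c i * z i ^ 2).aemeasurable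
  refine ⟨hlim.forall_aemeasurable, hchi, ?_⟩
  convert hlim.tendsto using 2
  exact congrArg 𝓝 (Subtype.ext hlaw.symm)
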